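/- Let $d\ge 1$, let $W\subset\mathbb R^d$ be compact and convex with Lebesgue measure $V(W)>0$, and for each $t>0$ let $\eta_t$ be a homogeneous Poisson point process of intensity $t$ in $W$ on a common probability space, i.e. a random finite set of distinct points of $W$ with $\mathbb P(\eta_t\cap A=\emptyset)=e^{-tV(A)}$ for every Borel set $A\subset W$, where $V$ denotes Lebesgue measure. Let $\delta_t>0$ for $t>0$, with $\delta_t\to0$ as $t\to\infty$, and for $\alpha\in\mathbb R$ put $$L_t^{(\alpha)}=\frac12\sum_{(x,y)\in\eta_t^2,\ x\ne y}\mathbf 1(\|x-y\|\le\delta_t)\,\|x-y\|^\alpha,\qquad \widetilde L_t^{(\alpha)}=\frac{L_t^{(\alpha)}}{\max\{t\,\delta_t^{\alpha+d/2},\,t^{3/2}\,\delta_t^{\alpha+d}\}}.$$ Let $m\ge2$ and let $\alpha_1,\dots,\alpha_m>-d/2$ be distinct. With $\kappa_d$ the volume of the unit ball of $\mathbb R^d$, put $$\Sigma_1=\frac{d\,\kappa_d\,V(W)}2\Big(\frac1{\alpha_i+\alpha_j+d}\Big)_{i,j=1}^m,\qquad \Sigma_2=d^2\kappa_d^2\,V(W)\Big(\frac1{(\alpha_i+d)(\alpha_j+d)}\Big)_{i,j=1}^m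 .$$ Then all $L_t^{(\alpha_i)}$, $t>0$, are square integrable, and whenever $\lim_{t\to\infty}t\,\delta_t^d$ exists in $[0,\infty]$, the asymptotic covariance matrix $$\Sigma=\lim_{t\to\infty}\big(\operatorname{Cov}(\widetilde L_t^{(\alpha_i)},\widetilde L_t^{(\alpha_j)})\big)_{i,j=1}^m$$ exists and has the following form and properties. 1. Sparse regime: if $t\,\delta_t^d\to0$, then $\Sigma=\Sigma_1$, and $\Sigma$ is positive definite. 2. Thermodynamic regime: if $t\,\delta_t^d\to c\in(0,\infty)$, then $\Sigma=\Sigma_1+c\,\Sigma_2$ for $c\le1$ and $\Sigma=\frac1c\Sigma_1+\Sigma_2$ for $c>1$, and in both cases $\Sigma$ is positive definite. 3. Dense regime: if $t\,\delta_t^d\to\infty$, then $\Sigma=\Sigma_2$, and $\Sigma$ has rank one; in particular it is singular. -/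

import Mathlib

open MeasureTheory Filter Topology

namespace GilbertGraph

noncomputable section

/-- `IsPoissonProcess W t η P`: under `P`, the random finite configuration `η` of distinct points
(a simple finite counting measure, identified with its support) is a homogeneous Poisson point
process of intensity `t` in the window `W`. That is, `η` takes values in the configurations in `W`,
it is a random variable for the `σ`-field generated by the counting maps `s ↦ #(s ∩ A)`, `A ⊆ W`
Borel, and `P(η(A) = 0) = exp(-t λ(A))` for every Borel set `A ⊆ W`, with `λ` the Lebesgue
measure. By Rényi's theorem this is the same as asking that the counts of disjoint Borel sets be
independent and Poisson distributed with means `t λ(A)`. -/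
structure IsPoissonProcess {d : ℕ} {Ω : Type*} [MeasurableSpace Ω]
    (W : Set (EuclideanSpace ℝ (Fin d))) (t : ℝ)
    (η : Ω → Finset (EuclideanSpace ℝ (Fin d))) (P : Measure Ω) : Prop where
  subset_window : ∀ ω, (η ω : Set (EuclideanSpace ℝ (Fin d))) ⊆ W
  measurable_count : ∀ A : Set (EuclideanSpace ℝ (Fin d)), MeasurableSet A → A ⊆ W →
    Measurable fun ω => ((η ω : Set (EuclideanSpace ℝ (Fin d))) ∩ A).ncard
  void_probability : ∀ A : Set (EuclideanSpace ℝ (Fin d)), MeasurableSet A → A ⊆ W →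
    P {ω | ((η ω : Set (EuclideanSpace ℝ (Fin d))) ∩ A).ncard = 0} =
      ENNReal.ofReal (Real.exp (-(t * volume.real A)))

open Classical in
/-- The length-power functional of the Gilbert graph with vertex set `s` and distance
parameter `r`: the sum of the `α`-th powers of all edge lengths, written as half of a sum over
ordered pairs of distinct points. -/
def lengthPower {d : ℕ} (α r : ℝ) (s : Finset (EuclideanSpace ℝ (Fin d))) : ℝ :=
  (1 / 2) * ∑ p ∈ s.offDiag, if ‖p.1 - p.2‖ ≤ r then ‖p.1 - p.2‖ ^ α else 0

/-- The normalised functional, `L / max {t r^(α + d/2), t^(3/2) r^(α + d)}`. -/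
def normalizedLengthPower {d : ℕ} (α t r : ℝ) (s : Finset (EuclideanSpace ℝ (Fin d))) : ℝ :=
  lengthPower α r s /
    max (t * r ^ (α + (d : ℝ) / 2)) (t ^ ((3 : ℝ) / 2) * r ^ (α + (d : ℝ)))

/-- The covariance matrix at intensity `t` of the vector of normalised functionals with
exponents `α 0, …, α (m - 1)`. -/
def covMatrix {d m : ℕ} {Ω : Type*} [MeasurableSpace Ω] (P : Measure Ω)
    (η : ℝ → Ω → Finset (EuclideanSpace ℝ (Fin d))) (δ : ℝ → ℝ) (α : Fin m → ℝ) (t : ℝ) :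
    Matrix (Fin m) (Fin m) ℝ :=
  Matrix.of fun i j => ProbabilityTheory.covariance
    (fun ω => normalizedLengthPower (α i) t (δ t) (η t ω))
    (fun ω => normalizedLengthPower (α j) t (δ t) (η t ω)) P

/-- The volume `κ_d` of the `d`-dimensional Euclidean unit ball. -/
def unitBallVolume (d : ℕ) : ℝ :=
  volume.real (Metric.closedBall (0 : EuclideanSpace ℝ (Fin d)) 1)

/-- The matrix `Σ₁ = (d κ_d V(W) / 2) (1 / (α_i + α_j + d))_{i,j}`. -/
def sigmaOne {d m : ℕ} (W : Set (EuclideanSpace ℝ (Fin d))) (α : Fin m → ℝ) :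
    Matrix (Fin m) (Fin m) ℝ :=
  ((d : ℝ) * unitBallVolume d * volume.real W / 2) •
    Matrix.of fun i j => 1 / (α i + α j + (d : ℝ))

/-- The matrix `Σ₂ = d² κ_d² V(W) (1 / ((α_i + d) (α_j + d)))_{i,j}`. -/
def sigmaTwo {d m : ℕ} (W : Set (EuclideanSpace ℝ (Fin d))) (α : Fin m → ℝ) :
    Matrix (Fin m) (Fin m) ℝ :=
  ((d : ℝ) ^ 2 * unitBallVolume d ^ 2 * volume.real W) •
    Matrix.of fun i j => 1 / ((α i + (d : ℝ)) * (α j + (d : ℝ)))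

end

end GilbertGraph

/-!
The void probabilities alone determine all factorial moment measures of a Poisson process. Encode
the points of the (countably generated) state space by infinite binary words and let the cells of
level `n` be the sets of points whose words share their first `n` letters. For a finite
configuration, the number of `k`-tuples of distinct cells met by it never exceeds the number of
`k`-tuples of distinct points, and both agree once the cells separate the points. Since the void
events of disjoint sets are independent, the expected number of tuples of cells is explicit; as the
intensity measure `μ` has no atoms, it tends to the `μ^k`-measure. Hence
`E ∑ F(x₁, …, x_k) = ∫ F dμ^k`, the sum running over tuples of distinct points
(`HasPoissonVoids.lintegral_sum_distinctTuples`).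

Splitting the product of two sums over pairs according to how many points the pairs share
(`pairSum_mul_pairSum`) turns the case `k ≤ 4` into a covariance formula for such sums
(`HasPoissonVoids.covariance_pairSum`): the pairs without a common point contribute the product of
the expectations, pairs with one common point contribute a term of order `t³`, and equal pairs a
term of order `t²`. For the length-power functionals both terms are integrals over `W` of local
integrals `x ↦ ∫_W 1(‖x - y‖ ≤ r) ‖x - y‖^β dy`. After division by `r^(β + d)` these are bounded by
`d κ_d / (β + d)` and, by polar coordinates, equal to it as soon as the ball of radius `r` around
`x` lies in `W`; the boundary of the convex set `W` being null, dominated convergence gives the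
limits. With `u = t δ_t^d` the covariance matrix is then asymptotically
`(1 / max 1 u) Σ₁ + (u / max 1 u) Σ₂` (`tendsto_covMatrix`), and the regimes differ only in the
limit of the coefficients.

Finally `Σ₁` is a positive multiple of the Cauchy matrix `(1 / (β_i + β_j))` with distinct
`β_i = α_i + d / 2 > 0`, the Gram matrix in `L²(0, ∞)` of the linearly independent functions
`s ↦ exp(-β_i s)`, while `Σ₂` is a positive multiple of `v vᵀ` with `v_i = 1 / (α_i + d)`.
-/

open scoped ENNReal

namespace GilbertGraph

noncomputable section

/-! ### Nested finite partitions separating points -/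

/-- The index of the level-`n` cell containing `x`: the first `n` letters of the binary word of `x`
with respect to a countable generating family of the σ-algebra. -/
def cellCode {E : Type*} [MeasurableSpace E] [MeasurableSpace.CountablyGenerated E]
    (n : ℕ) (x : E) : Fin n → Bool :=
  fun i => MeasurableSpace.mapNatBool E x i

lemma measurable_cellCode {E : Type*} [MeasurableSpace E] [MeasurableSpace.CountablyGenerated E]
    (n : ℕ) : Measurable (cellCode (E := E) n) :=
  measurable_pi_lambda _ fun i =>
    (measurable_pi_apply (i : ℕ)).comp (MeasurableSpace.measurable_mapNatBool E)

lemma eventually_cellCode_ne {E : Type*} [MeasurableSpace E]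
    [MeasurableSpace.CountablyGenerated E] [MeasurableSpace.SeparatesPoints E] {x y : E}
    (h : x ≠ y) : ∀ᶠ n in atTop, cellCode n x ≠ cellCode n y := by
  obtain ⟨i, hi⟩ := Function.ne_iff.mp ((MeasurableSpace.injective_mapNatBool E).ne h)
  filter_upwards [eventually_gt_atTop i] with n hn heq
  exact hi (congrFun heq ⟨i, hn⟩)

lemma eventually_injOn_cellCode {E : Type*} [MeasurableSpace E]
    [MeasurableSpace.CountablyGenerated E] [MeasurableSpace.SeparatesPoints E] (s : Finset E) :
    ∀ᶠ n in atTop, Set.InjOn (cellCode (E := E) n) s := by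
  have h : ∀ x ∈ s, ∀ y ∈ s, ∀ᶠ n in atTop, cellCode n x = cellCode n y → x = y := by
    intro x _ y _
    by_cases hxy : x = y
    · simp [hxy]
    · filter_upwards [eventually_cellCode_ne hxy] with n hn h using absurd h hn
  have h' : ∀ᶠ n in atTop, ∀ x ∈ s, ∀ y ∈ s, cellCode n x = cellCode n y → x = y := by
    rw [eventually_all_finset]
    intro x hx
    rw [eventually_all_finset]
    exact h x hx
  filter_upwards [h'] with n hn x hx y hy using hn x hx y hy

lemma tendsto_measureReal_cell {E : Type*} [MeasurableSpace E]
    [MeasurableSpace.CountablyGenerated E] [MeasurableSpace.SeparatesPoints E]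
    (μ : Measure E) [IsFiniteMeasure μ] [NullSingletonClass μ] (x : E) :
    Tendsto (fun n => μ.real (cellCode n ⁻¹' {cellCode n x})) atTop (𝓝 0) := by
  have hanti : Antitone fun n => (cellCode n ⁻¹' {cellCode n x} : Set E) := by
    intro a b hab y hy
    simp only [Set.mem_preimage, Set.mem_singleton_iff] at hy ⊢
    ext i
    exact congrFun hy ⟨i, i.2.trans_le hab⟩
  have hinter : (⋂ n, (cellCode n ⁻¹' {cellCode n x} : Set E)) = {x} := by
    ext y
    simp only [Set.mem_iInter, Set.mem_preimage, Set.mem_singleton_iff]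
    refine ⟨fun h => ?_, fun h n => by rw [h]⟩
    by_contra hne
    obtain ⟨n, hn⟩ := (eventually_cellCode_ne hne).exists
    exact hn (h n)
  have := tendsto_measure_iInter_atTop (μ := μ)
    (fun n => (measurable_cellCode n (measurableSet_singleton (cellCode n x))).nullMeasurableSet)
    hanti ⟨0, measure_ne_top _ _⟩
  rw [hinter, measure_singleton] at this
  simpa [Measure.real, Function.comp_def] using
    (ENNReal.tendsto_toReal ENNReal.zero_ne_top).comp this

/-! ### Void probabilities and hitting probabilities -/

/-- The random finite configuration `η` has the void probabilities of a Poisson process with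
intensity measure `μ`: no point lies in `A` with probability `exp (-μ A)`. As `μ.real` is used, this
is meaningful only for finite `μ`. -/
structure HasPoissonVoids {E Ω : Type*} [MeasurableSpace E] [MeasurableSpace Ω]
    (μ : Measure E) (η : Ω → Finset E) (P : Measure Ω) : Prop where
  measurableSet_void : ∀ A, MeasurableSet A → MeasurableSet {ω | Disjoint (η ω : Set E) A}
  prob_void : ∀ A, MeasurableSet A →
    P {ω | Disjoint (η ω : Set E) A} = ENNReal.ofReal (Real.exp (-μ.real A))

/-- Void events of disjoint sets are independent, because the void event of a union is the
intersection of the void events; hence so are their complements. -/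
lemma HasPoissonVoids.prob_hit {E Ω : Type*} [MeasurableSpace E] [MeasurableSpace Ω]
    {μ : Measure E} [IsFiniteMeasure μ] {η : Ω → Finset E} {P : Measure Ω}
    [IsProbabilityMeasure P]
    (h : HasPoissonVoids μ η P) {ι : Type*} [Fintype ι] (A : ι → Set E)
    (hA : ∀ i, MeasurableSet (A i)) (hdisj : Pairwise fun i j => Disjoint (A i) (A j)) :
    P (⋂ i, {ω | Disjoint (η ω : Set E) (A i)}ᶜ) =
      ∏ i, ENNReal.ofReal (1 - Real.exp (-μ.real (A i))) := by
  have hmeas i := h.measurableSet_void (A i) (hA i)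
  have hind : ProbabilityTheory.iIndepSet (fun i => {ω | Disjoint (η ω : Set E) (A i)}) P := by
    rw [ProbabilityTheory.iIndepSet_iff_meas_biInter hmeas]
    intro s
    have : (⋂ i ∈ s, {ω | Disjoint (η ω : Set E) (A i)}) =
        {ω | Disjoint (η ω : Set E) (⋃ i ∈ s, A i)} := by
      ext ω; simp [Set.disjoint_iUnion_right]
    rw [this, h.prob_void _ (s.measurableSet_biUnion fun i _ => hA i),
      measureReal_biUnion_finset (fun i _ j _ hij => hdisj hij) (fun i _ => hA i),
      ← Finset.sum_neg_distrib, Real.exp_sum, ENNReal.ofReal_prod_of_nonneg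
        (fun i _ => (Real.exp_pos _).le)]
    exact Finset.prod_congr rfl fun i _ => (h.prob_void _ (hA i)).symm
  have := ProbabilityTheory.iIndep.meas_iInter
    ((ProbabilityTheory.iIndepSet_iff_iIndep _ _).mp hind)
    (s := fun i => {ω | Disjoint (η ω : Set E) (A i)}ᶜ)
    (fun i => (MeasurableSpace.measurableSet_generateFrom (Set.mem_singleton _)).compl)
  rw [this]
  refine Finset.prod_congr rfl fun i _ => ?_
  rw [prob_compl_eq_one_sub (hmeas i), h.prob_void _ (hA i),
    ENNReal.ofReal_sub _ (Real.exp_pos _).le, ENNReal.ofReal_one]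

/-! ### Counting tuples of distinct points through tuples of distinct cells -/

open Classical in
/-- The `k`-tuples of pairwise distinct points of the configuration `s`. -/
def distinctTuples {E : Type*} (k : ℕ) (s : Finset E) : Finset (Fin k → E) :=
  {x ∈ Fintype.piFinset fun _ => s | Function.Injective x}

lemma mem_distinctTuples {E : Type*} {k : ℕ} {s : Finset E} {x : Fin k → E} :
    x ∈ distinctTuples k s ↔ (∀ i, x i ∈ s) ∧ Function.Injective x := by
  simp [distinctTuples]

/-- The factorial measure of order `k` of the configuration `s`: the counting measure on its
`k`-tuples of pairwise distinct points. -/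
def factorialMeasure {E : Type*} [MeasurableSpace E] (k : ℕ) (s : Finset E) :
    Measure (Fin k → E) :=
  ∑ x ∈ distinctTuples k s, Measure.dirac x

open Classical in
/-- The `k`-tuples `c` of pairwise distinct cells of level `n` such that `s` has a point in the
part of the cell `c i` inside `B i`, for all `i`. -/
def hitTuples {E : Type*} [MeasurableSpace E] [MeasurableSpace.CountablyGenerated E] {k : ℕ}
    (B : Fin k → Set E) (n : ℕ) (s : Finset E) : Finset (Fin k → Fin n → Bool) :=
  {c | Function.Injective c ∧ ∀ i, ¬ Disjoint (s : Set E) (B i ∩ cellCode n ⁻¹' {c i})}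

open Classical in
lemma factorialMeasure_pi {E : Type*} [MeasurableSpace E] {k : ℕ} (s : Finset E)
    {B : Fin k → Set E} (hB : ∀ i, MeasurableSet (B i)) :
    factorialMeasure k s (Set.univ.pi B) =
      (({x ∈ distinctTuples k s | ∀ i, x i ∈ B i} : Finset (Fin k → E)).card : ℝ≥0∞) := by
  rw [factorialMeasure, Measure.finsetSum_apply, Finset.card_filter, Nat.cast_sum]
  refine Finset.sum_congr rfl fun x _ => ?_
  rw [Measure.dirac_apply' _ (MeasurableSet.univ_pi hB)]
  by_cases hx : ∀ i, x i ∈ B i <;> simp [Set.indicator, hx]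

lemma card_hitTuples_le {E : Type*} [MeasurableSpace E] [MeasurableSpace.CountablyGenerated E]
    {k : ℕ} (s : Finset E) {B : Fin k → Set E} (hB : ∀ i, MeasurableSet (B i)) (n : ℕ) :
    ((hitTuples B n s).card : ℝ≥0∞) ≤ factorialMeasure k s (Set.univ.pi B) := by
  classical
  rw [factorialMeasure_pi s hB, Nat.cast_le]
  refine (Finset.card_le_card (t := Finset.image (fun x i => cellCode n (x i)) _) ?_).trans
    Finset.card_image_le
  intro c hc
  simp only [hitTuples, Finset.mem_filter, Finset.mem_univ, true_and, Set.not_disjoint_iff] at hc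
  choose x hxs hxB using hc.2
  refine Finset.mem_image.mpr ⟨x, ?_, funext fun i => (hxB i).2⟩
  simp only [Finset.mem_filter, mem_distinctTuples]
  refine ⟨⟨fun i => by simpa using hxs i, fun i j hij => hc.1 ?_⟩, fun i => (hxB i).1⟩
  rw [← (hxB i).2, ← (hxB j).2, hij]

lemma eventually_card_hitTuples {E : Type*} [MeasurableSpace E]
    [MeasurableSpace.CountablyGenerated E] [MeasurableSpace.SeparatesPoints E]
    {k : ℕ} (s : Finset E) {B : Fin k → Set E} (hB : ∀ i, MeasurableSet (B i)) :
    ∀ᶠ n in atTop,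
      ((hitTuples B n s).card : ℝ≥0∞) = factorialMeasure k s (Set.univ.pi B) := by
  classical
  filter_upwards [eventually_injOn_cellCode s] with n hn
  refine le_antisymm (card_hitTuples_le s hB n) ?_
  rw [factorialMeasure_pi s hB, Nat.cast_le]
  refine Finset.card_le_card_of_injOn (fun x i => cellCode n (x i)) ?_ ?_
  · intro x hx
    simp only [Finset.coe_filter, Set.mem_ofPred_eq, mem_distinctTuples] at hx
    simp only [hitTuples, Finset.coe_filter, Set.mem_ofPred_eq, Finset.mem_univ, true_and]
    exact ⟨fun i j hij => hx.1.2 (hn (hx.1.1 i) (hx.1.1 j) hij),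
      fun i => Set.not_disjoint_iff.mpr ⟨x i, hx.1.1 i, hx.2 i, rfl⟩⟩
  · intro x hx y hy hxy
    simp only [Finset.coe_filter, Set.mem_ofPred_eq, mem_distinctTuples] at hx hy
    exact funext fun i => hn (hx.1.1 i) (hy.1.1 i) (congrFun hxy i)

lemma card_hitTuples {E : Type*} [MeasurableSpace E] [MeasurableSpace.CountablyGenerated E]
    {Ω : Type*} {η : Ω → Finset E} {k : ℕ} (B : Fin k → Set E) (n : ℕ) (ω : Ω) :
    ((hitTuples B n (η ω)).card : ℝ≥0∞) =
      open Classical in ∑ c : Fin k → Fin n → Bool with Function.Injective c,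
        (⋂ i, {ω | Disjoint (η ω : Set E) (B i ∩ cellCode n ⁻¹' {c i})}ᶜ).indicator 1 ω := by
  classical
  rw [hitTuples, ← Finset.filter_filter, Finset.card_filter, Nat.cast_sum]
  refine Finset.sum_congr rfl fun c _ => ?_
  by_cases h : ∀ i, ¬ Disjoint (η ω : Set E) (B i ∩ cellCode n ⁻¹' {c i}) <;>
    simp [Set.indicator, h]

lemma HasPoissonVoids.measurableSet_hit {E Ω : Type*} [MeasurableSpace E]
    [MeasurableSpace.CountablyGenerated E] [MeasurableSpace Ω]
    {μ : Measure E} {η : Ω → Finset E} {P : Measure Ω}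
    (h : HasPoissonVoids μ η P) {k : ℕ} {B : Fin k → Set E} (hB : ∀ i, MeasurableSet (B i))
    (n : ℕ) (c : Fin k → Fin n → Bool) :
    MeasurableSet (⋂ i, {ω | Disjoint (η ω : Set E) (B i ∩ cellCode n ⁻¹' {c i})}ᶜ) :=
  MeasurableSet.iInter fun i => (h.measurableSet_void _
    ((hB i).inter (measurable_cellCode n (measurableSet_singleton _)))).compl

lemma HasPoissonVoids.measurable_card_hitTuples {E Ω : Type*} [MeasurableSpace E]
    [MeasurableSpace.CountablyGenerated E] [MeasurableSpace Ω]
    {μ : Measure E} {η : Ω → Finset E} {P : Measure Ω}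
    (h : HasPoissonVoids μ η P) {k : ℕ} {B : Fin k → Set E} (hB : ∀ i, MeasurableSet (B i))
    (n : ℕ) : Measurable fun ω => ((hitTuples B n (η ω)).card : ℝ≥0∞) := by
  classical
  simp_rw [card_hitTuples]
  exact Finset.measurable_fun_sum _ fun c _ =>
    measurable_one.indicator (h.measurableSet_hit hB n c)

lemma HasPoissonVoids.lintegral_card_hitTuples {E Ω : Type*} [MeasurableSpace E]
    [MeasurableSpace.CountablyGenerated E] [MeasurableSpace Ω]
    {μ : Measure E} [IsFiniteMeasure μ] {η : Ω → Finset E} {P : Measure Ω}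
    [IsProbabilityMeasure P]
    (h : HasPoissonVoids μ η P) {k : ℕ} {B : Fin k → Set E} (hB : ∀ i, MeasurableSet (B i))
    (n : ℕ) : ∫⁻ ω, ((hitTuples B n (η ω)).card : ℝ≥0∞) ∂P =
      open Classical in ∑ c : Fin k → Fin n → Bool with Function.Injective c,
        ∏ i, ENNReal.ofReal (1 - Real.exp (-(μ.restrict (B i)).real (cellCode n ⁻¹' {c i}))) := by
  classical
  simp_rw [card_hitTuples]
  rw [lintegral_finsetSum _ fun c _ =>
    measurable_one.indicator (h.measurableSet_hit hB n c)]
  refine Finset.sum_congr rfl fun c hc => ?_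
  have hcell i : MeasurableSet (cellCode n ⁻¹' {c i} : Set E) :=
    measurable_cellCode n (measurableSet_singleton _)
  rw [lintegral_indicator_one (h.measurableSet_hit hB n c), h.prob_hit]
  · refine Finset.prod_congr rfl fun i _ => ?_
    rw [measureReal_restrict_apply (hcell i), Set.inter_comm]
  · exact fun i => (hB i).inter (hcell i)
  · intro i j hij
    refine Disjoint.mono Set.inter_subset_right Set.inter_subset_right ?_
    refine Disjoint.preimage _ (Set.disjoint_singleton.mpr fun hne => hij ?_)
    exact (Finset.mem_filter.mp hc).2 hne

/-! ### Factorial moment measures -/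

lemma measure_pi_eval_eq {E : Type*} [MeasurableSpace E] [MeasurableEq E] {k : ℕ}
    (μ : Fin k → Measure E) [∀ i, IsFiniteMeasure (μ i)] [∀ i, NullSingletonClass (μ i)]
    {a b : Fin k} (hab : a ≠ b) : Measure.pi μ {x | x a = x b} = 0 := by
  obtain _ | k := k
  · exact a.elim0
  · obtain ⟨j, rfl⟩ := Fin.exists_succAbove_eq hab.symm
    have hmp := measurePreserving_piFinSuccAbove μ a
    have hs : MeasurableSet {p : E × (Fin k → E) | p.1 = p.2 j} :=
      measurableSet_eq_fun measurable_fst ((measurable_pi_apply j).comp measurable_snd)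
    have : {x : Fin (k + 1) → E | x a = x (a.succAbove j)} =
        MeasurableEquiv.piFinSuccAbove (fun _ => E) a ⁻¹' {p | p.1 = p.2 j} := by
      ext x; simp [MeasurableEquiv.piFinSuccAbove, Fin.insertNthEquiv, Fin.removeNth]
    rw [this, hmp.measure_preimage hs.nullMeasurableSet, Measure.prod_apply_symm hs]
    have h0 (y : Fin k → E) :
        (fun x => (x, y)) ⁻¹' {p : E × (Fin k → E) | p.1 = p.2 j} = {y j} := by
      ext x; simp
    simp [h0]

lemma ae_injective_pi {E : Type*} [MeasurableSpace E] [MeasurableEq E] {k : ℕ}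
    (μ : Fin k → Measure E) [∀ i, IsFiniteMeasure (μ i)] [∀ i, NullSingletonClass (μ i)] :
    ∀ᵐ x ∂Measure.pi μ, Function.Injective x := by
  have : ∀ᵐ x ∂Measure.pi μ, ∀ a b : Fin k, a ≠ b → x a ≠ x b := by
    rw [ae_all_iff]; intro a
    rw [ae_all_iff]; intro b
    by_cases hab : a = b
    · simp [hab]
    · have : ∀ᵐ x ∂Measure.pi μ, x a ≠ x b := by
        rw [ae_iff]; simpa using measure_pi_eval_eq μ hab
      filter_upwards [this] with x hx _ using hx
  filter_upwards [this] with x hx a b h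
  by_contra hne
  exact hx a b hne h

open Classical in
/-- The product of the `exp (-m i (c i))` if the cells `c i` are pairwise distinct, and `0`
otherwise. With `m i c` the measure of the cell `c`, its product with `∏ i, m i (c i)` is a lower bound for the
hitting probability `∏ i, (1 - exp (-m i (c i)))` of a tuple of distinct cells. -/
def cellWeight {k n : ℕ} (m : Fin k → (Fin n → Bool) → ℝ) (c : Fin k → Fin n → Bool) : ℝ≥0∞ :=
  if Function.Injective c then ENNReal.ofReal (∏ i, Real.exp (-m i (c i))) else 0

lemma lintegral_cellWeight_le {E : Type*} [MeasurableSpace E]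
    [MeasurableSpace.CountablyGenerated E] {k : ℕ} (n : ℕ)
    (μ : Fin k → Measure E) [∀ i, IsFiniteMeasure (μ i)] :
    ∫⁻ x, cellWeight (fun i c => (μ i).real (cellCode n ⁻¹' {c})) (fun i => cellCode n (x i))
      ∂Measure.pi μ ≤ open Classical in ∑ c : Fin k → Fin n → Bool with Function.Injective c,
        ∏ i, ENNReal.ofReal (1 - Real.exp (-(μ i).real (cellCode n ⁻¹' {c i}))) := by
  classical
  have hmeas : Measurable fun (x : Fin k → E) i => cellCode n (x i) :=
    measurable_pi_lambda _ fun i => (measurable_cellCode n).comp (measurable_pi_apply i)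
  rw [← lintegral_map (f := cellWeight fun i c => (μ i).real (cellCode n ⁻¹' {c}))
    (measurable_of_finite _) hmeas, lintegral_fintype, Finset.sum_filter]
  refine Finset.sum_le_sum fun c _ => ?_
  rw [Measure.map_apply hmeas (measurableSet_singleton c), cellWeight]
  split_ifs with hc
  · have : (fun (x : Fin k → E) i => cellCode n (x i)) ⁻¹' {c} =
        Set.univ.pi fun i => cellCode n ⁻¹' {c i} := by
      ext x; simp [funext_iff (f := fun i => cellCode n (x i))]
    rw [this, Measure.pi_pi, ENNReal.ofReal_prod_of_nonneg fun i _ => (Real.exp_pos _).le,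
      ← Finset.prod_mul_distrib]
    refine Finset.prod_le_prod' fun i _ => ?_
    set u := (μ i).real (cellCode n ⁻¹' {c i}) with hu
    rw [← ofReal_measureReal, ← hu, ← ENNReal.ofReal_mul (Real.exp_pos _).le]
    refine ENNReal.ofReal_le_ofReal ?_
    -- `u e^{-u} ≤ 1 - e^{-u}` is `1 + u ≤ e^u` multiplied by `e^{-u}`
    have h1 := mul_le_mul_of_nonneg_left (Real.add_one_le_exp u) (Real.exp_pos (-u)).le
    rw [← Real.exp_add, neg_add_cancel, Real.exp_zero] at h1
    linarith
  · simp

lemma tendsto_lintegral_cellWeight {E : Type*} [MeasurableSpace E] [MeasurableEq E]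
    [MeasurableSpace.CountablyGenerated E] [MeasurableSpace.SeparatesPoints E] {k : ℕ}
    (μ : Fin k → Measure E) [∀ i, IsFiniteMeasure (μ i)] [∀ i, NullSingletonClass (μ i)] :
    Tendsto (fun n => ∫⁻ x, cellWeight (fun i c => (μ i).real (cellCode n ⁻¹' {c}))
      (fun i => cellCode n (x i)) ∂Measure.pi μ) atTop (𝓝 (Measure.pi μ Set.univ)) := by
  classical
  have hlim : Measure.pi μ Set.univ = ∫⁻ _, 1 ∂Measure.pi μ := by simp
  rw [hlim]
  refine tendsto_lintegral_of_dominated_convergence (fun _ => 1) (fun n => ?_)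
    (fun n => ?_) (by simp) ?_
  · exact (measurable_of_finite (cellWeight fun i c => (μ i).real (cellCode n ⁻¹' {c}))).comp
      (measurable_pi_lambda _ fun i => (measurable_cellCode n).comp (measurable_pi_apply i))
  · refine Eventually.of_forall fun x => ?_
    simp only [cellWeight]
    split_ifs
    · rw [ENNReal.ofReal_le_one]
      refine Finset.prod_le_one (fun i _ => (Real.exp_pos _).le) fun i _ => ?_
      rw [Real.exp_le_one_iff, neg_nonpos]
      exact measureReal_nonneg
    · exact zero_le
  · filter_upwards [ae_injective_pi μ] with x hx
    have hinj : ∀ᶠ n in atTop, Function.Injective fun i => cellCode n (x i) := by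
      filter_upwards [eventually_injOn_cellCode (Finset.univ.image x)] with n hn i j hij
      exact hx (hn (by simp) (by simp) hij)
    have hprod : Tendsto (fun n => ∏ i, Real.exp (-(μ i).real (cellCode n ⁻¹' {cellCode n (x i)})))
        atTop (𝓝 (∏ i : Fin k, 1)) := by
      refine tendsto_finsetProd _ fun i _ => ?_
      simpa using (tendsto_measureReal_cell (μ i) (x i)).neg.rexp
    rw [Finset.prod_const_one] at hprod
    have hprod' := (ENNReal.continuous_ofReal.tendsto _).comp hprod
    rw [ENNReal.ofReal_one] at hprod'
    refine hprod'.congr' ?_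
    filter_upwards [hinj] with n hn
    simp [cellWeight, hn]

lemma sum_prod_ofReal_le {E : Type*} [MeasurableSpace E]
    [MeasurableSpace.CountablyGenerated E] {k : ℕ} (n : ℕ)
    (μ : Fin k → Measure E) [∀ i, IsFiniteMeasure (μ i)] :
    (open Classical in ∑ c : Fin k → Fin n → Bool with Function.Injective c,
        ∏ i, ENNReal.ofReal (1 - Real.exp (-(μ i).real (cellCode n ⁻¹' {c i})))) ≤
      Measure.pi μ Set.univ := by
  classical
  calc _ ≤ ∑ c : Fin k → Fin n → Bool, ∏ i, μ i (cellCode n ⁻¹' {c i}) := by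
        refine (Finset.sum_le_sum_of_subset (Finset.filter_subset _ _)).trans
          (Finset.sum_le_sum fun c _ => Finset.prod_le_prod' fun i _ => ?_)
        rw [← ofReal_measureReal]
        refine ENNReal.ofReal_le_ofReal ?_
        have := Real.add_one_le_exp (-(μ i).real (cellCode n ⁻¹' {c i}))
        linarith
    _ = ∏ i, ∑ c : Fin n → Bool, μ i (cellCode n ⁻¹' {c}) := by
        rw [Finset.prod_univ_sum, Fintype.piFinset_univ]
    _ = Measure.pi μ Set.univ := by
        rw [Measure.pi_univ]
        refine Finset.prod_congr rfl fun i _ => ?_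
        rw [sum_measure_preimage_singleton _
          fun c _ => measurable_cellCode n (measurableSet_singleton c)]
        simp

lemma HasPoissonVoids.measurable_factorialMeasure_pi {E Ω : Type*} [MeasurableSpace E]
    [MeasurableSpace.CountablyGenerated E] [MeasurableSpace.SeparatesPoints E] [MeasurableSpace Ω]
    {μ : Measure E} {η : Ω → Finset E} {P : Measure Ω}
    (h : HasPoissonVoids μ η P) {k : ℕ} {B : Fin k → Set E}
    (hB : ∀ i, MeasurableSet (B i)) :
    Measurable fun ω => factorialMeasure k (η ω) (Set.univ.pi B) :=
  measurable_of_tendsto_metrizable (fun n => h.measurable_card_hitTuples hB n)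
    (tendsto_pi_nhds.mpr fun ω => tendsto_const_nhds.congr' <| by
      filter_upwards [eventually_card_hitTuples (η ω) hB] with n hn using hn.symm)

/-- The upper bound is Fatou's lemma for the number of hit tuples of cells together with
`1 - exp (-u) ≤ u`; the lower bound follows from `u * exp (-u) ≤ 1 - exp (-u)`. -/
lemma HasPoissonVoids.lintegral_factorialMeasure_pi
    {E Ω : Type*} [MeasurableSpace E] [MeasurableEq E]
    [MeasurableSpace.CountablyGenerated E] [MeasurableSpace.SeparatesPoints E] [MeasurableSpace Ω]
    {μ : Measure E} [IsFiniteMeasure μ] [NullSingletonClass μ]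
    {η : Ω → Finset E} {P : Measure Ω} [IsProbabilityMeasure P]
    (h : HasPoissonVoids μ η P) {k : ℕ} {B : Fin k → Set E}
    (hB : ∀ i, MeasurableSet (B i)) :
    ∫⁻ ω, factorialMeasure k (η ω) (Set.univ.pi B) ∂P = ∏ i, μ (B i) := by
  have hpi : Measure.pi (fun i => μ.restrict (B i)) Set.univ = ∏ i, μ (B i) := by
    simp [Measure.pi_univ]
  rw [← hpi]
  refine le_antisymm ?_ ?_
  · calc ∫⁻ ω, factorialMeasure k (η ω) (Set.univ.pi B) ∂P
        = ∫⁻ ω, liminf (fun n => ((hitTuples B n (η ω)).card : ℝ≥0∞)) atTop ∂P := by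
          refine lintegral_congr fun ω => (Tendsto.liminf_eq ?_).symm
          refine tendsto_const_nhds.congr' ?_
          filter_upwards [eventually_card_hitTuples (η ω) hB] with n hn using hn.symm
      _ ≤ liminf (fun n => ∫⁻ ω, ((hitTuples B n (η ω)).card : ℝ≥0∞) ∂P) atTop :=
          lintegral_liminf_le fun n => h.measurable_card_hitTuples hB n
      _ ≤ _ := by
          refine liminf_le_of_le (by isBoundedDefault) fun b hb => ?_
          obtain ⟨n, hn⟩ := hb.exists
          refine hn.trans ?_
          rw [h.lintegral_card_hitTuples hB]
          exact sum_prod_ofReal_le n _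
  · refine le_of_tendsto (tendsto_lintegral_cellWeight fun i => μ.restrict (B i))
      (Eventually.of_forall fun n => (lintegral_cellWeight_le n _).trans ?_)
    rw [← h.lintegral_card_hitTuples hB]
    exact lintegral_mono fun ω => card_hitTuples_le _ hB n

instance {E : Type*} [MeasurableSpace E] (k : ℕ) (s : Finset E) :
    IsFiniteMeasure (factorialMeasure k s) := by
  unfold factorialMeasure; infer_instance

lemma HasPoissonVoids.measurable_factorialMeasure {E Ω : Type*} [MeasurableSpace E]
    [MeasurableSpace.CountablyGenerated E] [MeasurableSpace.SeparatesPoints E] [MeasurableSpace Ω]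
    {μ : Measure E} {η : Ω → Finset E} {P : Measure Ω}
    (h : HasPoissonVoids μ η P) (k : ℕ) :
    Measurable fun ω => factorialMeasure k (η ω) := by
  refine Measurable.measure_of_isPiSystem generateFrom_pi.symm isPiSystem_pi ?_ ?_
  · rintro _ ⟨B, hB, rfl⟩
    exact h.measurable_factorialMeasure_pi fun i => hB i (Set.mem_univ i)
  · simpa using h.measurable_factorialMeasure_pi (k := k) (B := fun _ => Set.univ)
      fun _ => MeasurableSet.univ

lemma HasPoissonVoids.bind_factorialMeasure {E Ω : Type*} [MeasurableSpace E] [MeasurableEq E]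
    [MeasurableSpace.CountablyGenerated E] [MeasurableSpace.SeparatesPoints E] [MeasurableSpace Ω]
    {μ : Measure E} [IsFiniteMeasure μ] [NullSingletonClass μ]
    {η : Ω → Finset E} {P : Measure Ω} [IsProbabilityMeasure P]
    (h : HasPoissonVoids μ η P) (k : ℕ) :
    P.bind (fun ω => factorialMeasure k (η ω)) = Measure.pi fun _ => μ := by
  refine (Measure.pi_eq fun B hB => ?_).symm
  rw [Measure.bind_apply (MeasurableSet.univ_pi hB) (h.measurable_factorialMeasure k).aemeasurable,
    h.lintegral_factorialMeasure_pi hB]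

lemma lintegral_factorialMeasure {E : Type*} [MeasurableSpace E] {k : ℕ} (s : Finset E)
    {F : (Fin k → E) → ℝ≥0∞} (hF : Measurable F) :
    ∫⁻ x, F x ∂factorialMeasure k s = ∑ x ∈ distinctTuples k s, F x := by
  rw [factorialMeasure, lintegral_finsetSum_measure]
  exact Finset.sum_congr rfl fun x _ => lintegral_dirac' x hF

lemma HasPoissonVoids.measurable_sum_distinctTuples {E Ω : Type*} [MeasurableSpace E]
    [MeasurableSpace.CountablyGenerated E] [MeasurableSpace.SeparatesPoints E] [MeasurableSpace Ω]
    {μ : Measure E} {η : Ω → Finset E} {P : Measure Ω}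
    (h : HasPoissonVoids μ η P) {k : ℕ}
    {F : (Fin k → E) → ℝ≥0∞} (hF : Measurable F) :
    Measurable fun ω => ∑ x ∈ distinctTuples k (η ω), F x := by
  simp_rw [← lintegral_factorialMeasure _ hF]
  exact (Measure.measurable_lintegral hF).comp (h.measurable_factorialMeasure k)

/-- The multivariate Campbell formula for a Poisson process with intensity measure `μ`. -/
lemma HasPoissonVoids.lintegral_sum_distinctTuples
    {E Ω : Type*} [MeasurableSpace E] [MeasurableEq E]
    [MeasurableSpace.CountablyGenerated E] [MeasurableSpace.SeparatesPoints E] [MeasurableSpace Ω]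
    {μ : Measure E} [IsFiniteMeasure μ] [NullSingletonClass μ]
    {η : Ω → Finset E} {P : Measure Ω} [IsProbabilityMeasure P]
    (h : HasPoissonVoids μ η P) {k : ℕ}
    {F : (Fin k → E) → ℝ≥0∞} (hF : Measurable F) :
    ∫⁻ ω, ∑ x ∈ distinctTuples k (η ω), F x ∂P = ∫⁻ x, F x ∂Measure.pi fun _ => μ := by
  rw [← h.bind_factorialMeasure k,
    Measure.lintegral_bind (h.measurable_factorialMeasure k).aemeasurable hF.aemeasurable]
  exact lintegral_congr fun ω => (lintegral_factorialMeasure _ hF).symm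

/-! ### Sums over pairs of distinct points -/

open Classical in
lemma sum_distinctTuples_succ {E M : Type*} [AddCommMonoid M] (k : ℕ) (s : Finset E)
    (F : (Fin (k + 1) → E) → M) :
    ∑ x ∈ distinctTuples (k + 1) s, F x =
      ∑ a ∈ s, ∑ y ∈ distinctTuples k (s.erase a), F (Fin.cons a y) := by
  rw [Finset.sum_sigma']
  refine Finset.sum_bij' (fun x _ => ⟨x 0, Fin.tail x⟩) (fun p _ => Fin.cons p.1 p.2) ?_ ?_ ?_ ?_ ?_
  · intro x hx
    rw [mem_distinctTuples] at hx
    simp only [Finset.mem_sigma, mem_distinctTuples, Finset.mem_erase]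
    exact ⟨hx.1 0, fun i => ⟨fun h => Fin.succ_ne_zero i (hx.2 h), hx.1 _⟩,
      hx.2.comp (Fin.succ_injective k)⟩
  · rintro ⟨a, y⟩ h
    simp only [Finset.mem_sigma, mem_distinctTuples, Finset.mem_erase] at h
    rw [mem_distinctTuples, Fin.cons_injective_iff]
    refine ⟨Fin.cases h.1 fun i => (h.2.1 i).2, ?_, h.2.2⟩
    rintro ⟨i, hi⟩
    exact (h.2.1 i).1 hi
  · intro x _; simp
  · rintro ⟨a, y⟩ _; simp
  · intro x _; simp

lemma distinctTuples_zero {E : Type*} (s : Finset E) : distinctTuples 0 s = Finset.univ := by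
  ext x
  simp [mem_distinctTuples, Function.injective_of_subsingleton, Subsingleton.elim x default]

open Classical in
lemma sum_offDiag_eq {E M : Type*} [AddCommMonoid M] (s : Finset E) (f : E × E → M) :
    ∑ p ∈ s.offDiag, f p = ∑ a ∈ s, ∑ b ∈ s.erase a, f (a, b) := by
  rw [Finset.sum_sigma']
  refine Finset.sum_bij' (fun p _ => ⟨p.1, p.2⟩) (fun p _ => (p.1, p.2)) ?_ ?_ ?_ ?_ ?_ <;>
    simp +contextual [Finset.mem_offDiag, eq_comm]

open Classical in
/-- The sum of `f` over the ordered pairs of distinct points of `s`. -/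
def pairSum {E : Type*} (f : E × E → ℝ≥0∞) (s : Finset E) : ℝ≥0∞ :=
  ∑ p ∈ s.offDiag, f p

open Classical in
lemma pairSum_eq {E : Type*} (f : E × E → ℝ≥0∞) (s : Finset E) :
    pairSum f s = ∑ a ∈ s, ∑ b ∈ s.erase a, f (a, b) := by
  rw [pairSum, sum_offDiag_eq]

open Classical in
/-- Removing a point `a` removes the pairs containing it, each counted in both orders. -/
lemma pairSum_erase {E : Type*} {f : E × E → ℝ≥0∞} (hf : ∀ x y, f (x, y) = f (y, x)) {s : Finset E}
    {a : E} (ha : a ∈ s) :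
    pairSum f s = pairSum f (s.erase a) + 2 * ∑ b ∈ s.erase a, f (a, b) := by
  have h : ∑ c ∈ s.erase a, ∑ d ∈ s.erase c, f (c, d) =
      ∑ c ∈ s.erase a, (f (a, c) + ∑ d ∈ (s.erase a).erase c, f (c, d)) := by
    refine Finset.sum_congr rfl fun c hc => ?_
    rw [← Finset.add_sum_erase (s.erase c) (fun d => f (c, d))
      (Finset.mem_erase.mpr ⟨(Finset.ne_of_mem_erase hc).symm, ha⟩), hf c a,
      Finset.erase_right_comm]
  rw [pairSum_eq, pairSum_eq, ← Finset.add_sum_erase s _ ha, h, Finset.sum_add_distrib]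
  ring

open Classical in
lemma sum_sum_erase_comm {E M : Type*} [AddCommMonoid M] (s : Finset E) (F : E → E → M) :
    ∑ a ∈ s, ∑ b ∈ s.erase a, F a b = ∑ a ∈ s, ∑ b ∈ s.erase a, F b a :=
  Finset.sum_comm' fun a b => by
    simp only [Finset.mem_erase]
    tauto

lemma pairSum_eq_distinctTuples {E : Type*} (f : E × E → ℝ≥0∞) (s : Finset E) :
    pairSum f s = ∑ x ∈ distinctTuples 2 s, f (x 0, x 1) := by
  simp [pairSum_eq, sum_distinctTuples_succ, distinctTuples_zero]

/-- The product of two sums over pairs, split according to the number of points that the two pairs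
share. If they share exactly one, it has two possible positions in each pair, whence the factor `4`;
if they share both, the second pair has two orderings, whence the factor `2`. -/
lemma pairSum_mul_pairSum {E : Type*} {f g : E × E → ℝ≥0∞} (hf : ∀ x y, f (x, y) = f (y, x))
    (hg : ∀ x y, g (x, y) = g (y, x)) (s : Finset E) :
    pairSum f s * pairSum g s =
      ∑ x ∈ distinctTuples 4 s, f (x 0, x 1) * g (x 2, x 3) +
      4 * ∑ x ∈ distinctTuples 3 s, f (x 0, x 1) * g (x 0, x 2) +
      2 * ∑ x ∈ distinctTuples 2 s, f (x 0, x 1) * g (x 0, x 1) := by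
  classical
  have h4 : ∑ x ∈ distinctTuples 4 s, f (x 0, x 1) * g (x 2, x 3) =
      ∑ a ∈ s, ∑ b ∈ s.erase a, f (a, b) * pairSum g ((s.erase a).erase b) := by
    simp [pairSum_eq, sum_distinctTuples_succ, distinctTuples_zero, Finset.mul_sum]
    rfl
  have h3 : ∑ x ∈ distinctTuples 3 s, f (x 0, x 1) * g (x 0, x 2) =
      ∑ a ∈ s, ∑ b ∈ s.erase a, f (a, b) * ∑ c ∈ (s.erase a).erase b, g (a, c) := by
    simp [sum_distinctTuples_succ, distinctTuples_zero, Finset.mul_sum]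
    rfl
  have h3' : ∑ a ∈ s, ∑ b ∈ s.erase a, f (a, b) * ∑ c ∈ (s.erase a).erase b, g (b, c) =
      ∑ a ∈ s, ∑ b ∈ s.erase a, f (a, b) * ∑ c ∈ (s.erase a).erase b, g (a, c) := by
    rw [sum_sum_erase_comm]
    simp_rw [hf, Finset.erase_right_comm]
  have h2 : ∑ x ∈ distinctTuples 2 s, f (x 0, x 1) * g (x 0, x 1) =
      ∑ a ∈ s, ∑ b ∈ s.erase a, f (a, b) * g (a, b) := by
    simp [sum_distinctTuples_succ, distinctTuples_zero]
  have key : pairSum f s * pairSum g s = ∑ a ∈ s, ∑ b ∈ s.erase a,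
      (f (a, b) * pairSum g ((s.erase a).erase b) +
        2 * (f (a, b) * ∑ c ∈ (s.erase a).erase b, g (b, c)) +
        2 * (f (a, b) * ∑ c ∈ (s.erase a).erase b, g (a, c)) + 2 * (f (a, b) * g (a, b))) := by
    rw [pairSum_eq f, Finset.sum_mul]
    refine Finset.sum_congr rfl fun a ha => ?_
    rw [Finset.sum_mul]
    refine Finset.sum_congr rfl fun b hb => ?_
    rw [pairSum_erase hg ha, pairSum_erase hg hb, ← Finset.add_sum_erase _ (fun c => g (a, c)) hb]
    ring
  rw [key, h4, h3, h2]
  simp_rw [Finset.sum_add_distrib, ← Finset.mul_sum]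
  rw [h3']
  ring

/-! ### First and second moments of sums over pairs -/

lemma lintegral_pi_succ {E : Type*} [MeasurableSpace E] (μ : Measure E) [SigmaFinite μ] {k : ℕ}
    {F : (Fin (k + 1) → E) → ℝ≥0∞} (hF : Measurable F) :
    ∫⁻ x, F x ∂Measure.pi (fun _ => μ) =
      ∫⁻ a, ∫⁻ y, F (Fin.cons a y) ∂Measure.pi (fun _ => μ) ∂μ := by
  have h := (measurePreserving_piFinSuccAbove (fun _ : Fin (k + 1) => μ) 0).symm
  rw [← h.lintegral_comp hF]
  refine (lintegral_prod _ (hF.comp h.measurable).aemeasurable).trans ?_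
  simp [MeasurableEquiv.piFinSuccAbove, Fin.insertNthEquiv]

lemma lintegral_pi_one {E : Type*} [MeasurableSpace E] (μ : Measure E) [SigmaFinite μ]
    {F : E → ℝ≥0∞} (hF : Measurable F) :
    ∫⁻ x, F (x 0) ∂Measure.pi (fun _ : Fin 1 => μ) = ∫⁻ a, F a ∂μ := by
  rw [lintegral_pi_succ μ (by fun_prop)]
  simp

lemma lintegral_pi_two {E : Type*} [MeasurableSpace E] (μ : Measure E) [SigmaFinite μ]
    {f : E × E → ℝ≥0∞} (hf : Measurable f) :
    ∫⁻ x, f (x 0, x 1) ∂Measure.pi (fun _ : Fin 2 => μ) = ∫⁻ a, ∫⁻ b, f (a, b) ∂μ ∂μ := by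
  rw [lintegral_pi_succ μ (by fun_prop)]
  exact lintegral_congr fun a => lintegral_pi_one μ (F := fun b => f (a, b)) (by fun_prop)

lemma lintegral_pi_three {E : Type*} [MeasurableSpace E] (μ : Measure E) [SigmaFinite μ]
    {f g : E × E → ℝ≥0∞} (hf : Measurable f) (hg : Measurable g) :
    ∫⁻ x, f (x 0, x 1) * g (x 0, x 2) ∂Measure.pi (fun _ : Fin 3 => μ) =
      ∫⁻ a, (∫⁻ b, f (a, b) ∂μ) * ∫⁻ b, g (a, b) ∂μ ∂μ := by
  rw [lintegral_pi_succ μ (by fun_prop)]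
  refine lintegral_congr fun a => ?_
  refine (lintegral_pi_two μ (f := fun p => f (a, p.1) * g (a, p.2)) (by fun_prop)).trans ?_
  rw [← lintegral_mul_const _ (by fun_prop)]
  exact lintegral_congr fun b =>
    lintegral_const_mul (f (a, b)) (f := fun c => g (a, c)) (by fun_prop)

lemma lintegral_pi_four {E : Type*} [MeasurableSpace E] (μ : Measure E) [SigmaFinite μ]
    {f g : E × E → ℝ≥0∞} (hf : Measurable f) (hg : Measurable g) :
    ∫⁻ x, f (x 0, x 1) * g (x 2, x 3) ∂Measure.pi (fun _ : Fin 4 => μ) =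
      (∫⁻ a, ∫⁻ b, f (a, b) ∂μ ∂μ) * ∫⁻ a, ∫⁻ b, g (a, b) ∂μ ∂μ := by
  rw [lintegral_pi_succ μ (by fun_prop), ← lintegral_mul_const _ (by fun_prop)]
  refine lintegral_congr fun a => ?_
  refine (lintegral_pi_succ μ (F := fun x : Fin 3 → E => f (a, x 0) * g (x 1, x 2))
    (by fun_prop)).trans ?_
  rw [← lintegral_mul_const _ (by fun_prop)]
  refine lintegral_congr fun b => ?_
  refine (lintegral_pi_two μ (f := fun p => f (a, b) * g (p.1, p.2)) (by fun_prop)).trans ?_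
  rw [← lintegral_const_mul _ (by fun_prop)]
  exact lintegral_congr fun c => lintegral_const_mul _ (by fun_prop)

section

variable {E Ω : Type*} [MeasurableSpace E]
    [MeasurableSpace.CountablyGenerated E] [MeasurableSpace.SeparatesPoints E] [MeasurableSpace Ω]
    {μ : Measure E} {η : Ω → Finset E} {P : Measure Ω}

lemma HasPoissonVoids.measurable_pairSum (h : HasPoissonVoids μ η P) {f : E × E → ℝ≥0∞}
    (hf : Measurable f) : Measurable fun ω => pairSum f (η ω) := by
  simp_rw [pairSum_eq_distinctTuples]
  exact h.measurable_sum_distinctTuples (F := fun x => f (x 0, x 1)) (by fun_prop)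

variable [MeasurableEq E] [IsFiniteMeasure μ] [NullSingletonClass μ] [IsProbabilityMeasure P]

lemma HasPoissonVoids.lintegral_pairSum (h : HasPoissonVoids μ η P) {f : E × E → ℝ≥0∞}
    (hf : Measurable f) :
    ∫⁻ ω, pairSum f (η ω) ∂P = ∫⁻ a, ∫⁻ b, f (a, b) ∂μ ∂μ := by
  simp_rw [pairSum_eq_distinctTuples]
  rw [h.lintegral_sum_distinctTuples (F := fun x => f (x 0, x 1)) (by fun_prop),
    lintegral_pi_two μ hf]

lemma HasPoissonVoids.lintegral_pairSum_mul (h : HasPoissonVoids μ η P) {f g : E × E → ℝ≥0∞}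
    (hf : Measurable f) (hg : Measurable g) (hfs : ∀ x y, f (x, y) = f (y, x))
    (hgs : ∀ x y, g (x, y) = g (y, x)) :
    ∫⁻ ω, pairSum f (η ω) * pairSum g (η ω) ∂P =
      (∫⁻ a, ∫⁻ b, f (a, b) ∂μ ∂μ) * (∫⁻ a, ∫⁻ b, g (a, b) ∂μ ∂μ) +
      4 * ∫⁻ a, (∫⁻ b, f (a, b) ∂μ) * ∫⁻ b, g (a, b) ∂μ ∂μ +
      2 * ∫⁻ a, ∫⁻ b, f (a, b) * g (a, b) ∂μ ∂μ := by
  simp_rw [pairSum_mul_pairSum hfs hgs]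
  have m4 : Measurable fun x : Fin 4 → E => f (x 0, x 1) * g (x 2, x 3) := by fun_prop
  have m3 : Measurable fun x : Fin 3 → E => f (x 0, x 1) * g (x 0, x 2) := by fun_prop
  have m2 : Measurable fun x : Fin 2 → E => f (x 0, x 1) * g (x 0, x 1) := by fun_prop
  rw [lintegral_add_right _ ((h.measurable_sum_distinctTuples m2).const_mul _),
    lintegral_add_right _ ((h.measurable_sum_distinctTuples m3).const_mul _),
    lintegral_const_mul _ (h.measurable_sum_distinctTuples m3),
    lintegral_const_mul _ (h.measurable_sum_distinctTuples m2),
    h.lintegral_sum_distinctTuples m4, h.lintegral_sum_distinctTuples m3,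
    h.lintegral_sum_distinctTuples m2, lintegral_pi_four μ hf hg, lintegral_pi_three μ hf hg,
    lintegral_pi_two μ (f := fun p => f p * g p) (hf.mul hg)]

/-- A symmetric measurable kernel for which the sum over pairs of a Poisson process with intensity
measure `μ` has finite first and second moments. -/
structure SquareIntegrableKernel (μ : Measure E) (f : E × E → ℝ≥0∞) : Prop where
  measurable : Measurable f
  symm : ∀ x y, f (x, y) = f (y, x)
  lintegral_ne_top : ∫⁻ a, ∫⁻ b, f (a, b) ∂μ ∂μ ≠ ∞
  lintegral_sq_ne_top : ∫⁻ a, ∫⁻ b, f (a, b) * f (a, b) ∂μ ∂μ ≠ ∞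
  lintegral_marginal_sq_ne_top :
    ∫⁻ a, (∫⁻ b, f (a, b) ∂μ) * ∫⁻ b, f (a, b) ∂μ ∂μ ≠ ∞

lemma HasPoissonVoids.memLp_pairSum (h : HasPoissonVoids μ η P) {f : E × E → ℝ≥0∞}
    (hf : SquareIntegrableKernel μ f) :
    MemLp (fun ω => (pairSum f (η ω)).toReal) 2 P := by
  have hm := h.measurable_pairSum hf.measurable
  rw [memLp_two_iff_integrable_sq hm.ennreal_toReal.aestronglyMeasurable]
  have : (fun ω => (pairSum f (η ω)).toReal ^ 2) =
      fun ω => (pairSum f (η ω) * pairSum f (η ω)).toReal := by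
    ext ω; rw [ENNReal.toReal_mul, sq]
  rw [this]
  refine integrable_toReal_of_lintegral_ne_top (hm.mul hm).aemeasurable ?_
  rw [h.lintegral_pairSum_mul hf.measurable hf.measurable hf.symm hf.symm]
  have h1 := hf.lintegral_ne_top
  have h2 := hf.lintegral_sq_ne_top
  have h3 := hf.lintegral_marginal_sq_ne_top
  finiteness

lemma HasPoissonVoids.covariance_pairSum (h : HasPoissonVoids μ η P) {f g : E × E → ℝ≥0∞}
    (hf : SquareIntegrableKernel μ f) (hg : SquareIntegrableKernel μ g) :
    ProbabilityTheory.covariance (fun ω => (pairSum f (η ω)).toReal)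
      (fun ω => (pairSum g (η ω)).toReal) P =
      4 * (∫⁻ a, (∫⁻ b, f (a, b) ∂μ) * ∫⁻ b, g (a, b) ∂μ ∂μ).toReal +
      2 * (∫⁻ a, ∫⁻ b, f (a, b) * g (a, b) ∂μ ∂μ).toReal := by
  have hXm := h.measurable_pairSum hf.measurable
  have hYm := h.measurable_pairSum hg.measurable
  have hX := h.memLp_pairSum hf
  have hY := h.memLp_pairSum hg
  have hXlt : ∀ᵐ ω ∂P, pairSum f (η ω) < ∞ := by
    refine ae_lt_top hXm ?_
    rw [h.lintegral_pairSum hf.measurable]; exact hf.lintegral_ne_top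
  have hYlt : ∀ᵐ ω ∂P, pairSum g (η ω) < ∞ := by
    refine ae_lt_top hYm ?_
    rw [h.lintegral_pairSum hg.measurable]; exact hg.lintegral_ne_top
  have hXY : ∫⁻ ω, pairSum f (η ω) * pairSum g (η ω) ∂P ≠ ∞ := by
    have hint := hX.integrable_mul hY
    have hne := hint.hasFiniteIntegral.ne
    refine ne_of_eq_of_ne (lintegral_congr_ae ?_) hne
    filter_upwards [hXlt, hYlt] with ω h1 h2
    simp [h1.ne, h2.ne, Real.enorm_eq_ofReal, ENNReal.ofReal_toReal]
  have hprod : (∫ ω, (pairSum f (η ω)).toReal * (pairSum g (η ω)).toReal ∂P) =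
      (∫⁻ ω, pairSum f (η ω) * pairSum g (η ω) ∂P).toReal := by
    rw [← integral_toReal (f := fun ω => pairSum f (η ω) * pairSum g (η ω))
      (hXm.mul hYm).aemeasurable]
    · simp
    · filter_upwards [hXlt, hYlt] with ω h1 h2 using ENNReal.mul_lt_top h1 h2
  rw [ProbabilityTheory.covariance_eq_sub hX hY]
  simp only [Pi.mul_apply]
  rw [hprod, integral_toReal hXm.aemeasurable hXlt, integral_toReal hYm.aemeasurable hYlt]
  rw [h.lintegral_pairSum_mul hf.measurable hg.measurable hf.symm hg.symm] at hXY ⊢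
  rw [h.lintegral_pairSum hf.measurable, h.lintegral_pairSum hg.measurable]
  rw [ENNReal.add_ne_top, ENNReal.add_ne_top] at hXY
  rw [ENNReal.toReal_add (ENNReal.add_ne_top.mpr hXY.1) hXY.2,
    ENNReal.toReal_add hXY.1.1 hXY.1.2]
  simp only [ENNReal.toReal_mul, ENNReal.toReal_ofNat]
  ring

end

/-! ### Truncated powers of the distance -/

/-- The power `y ^ α`, cut off beyond `r`; only used for `0 ≤ y`. -/
def radialPower (α r y : ℝ) : ℝ := if y ≤ r then y ^ α else 0

lemma radialPower_nonneg {α r y : ℝ} (hy : 0 ≤ y) : 0 ≤ radialPower α r y := by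
  unfold radialPower; split_ifs <;> positivity

lemma measurable_radialPower (α r : ℝ) : Measurable (radialPower α r) :=
  Measurable.ite measurableSet_Iic (by fun_prop) measurable_const

lemma smul_radialPower_eq {d : ℕ} (hd : 1 ≤ d) (α r : ℝ) :
    Set.EqOn (fun y : ℝ => y ^ (d - 1) • radialPower α r y)
      ((Set.Ioc 0 r).indicator fun y => y ^ (α + d - 1)) (Set.Ioi 0) := by
  intro y hy
  have hy : 0 < y := hy
  by_cases h : y ≤ r
  · have : (d : ℝ) - 1 = ((d - 1 : ℕ) : ℝ) := by push_cast [hd]; ring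
    simp only [radialPower, h, if_true, smul_eq_mul, Set.indicator, Set.mem_Ioc, hy, and_self]
    rw [← Real.rpow_natCast, ← Real.rpow_add hy, ← this]
    congr 1; ring
  · simp [radialPower, h, Set.indicator]

/-- The constant `d κ_d / (β + d)`, the integral of `‖z‖ ^ β` over the unit ball if
`-d < β`. -/
def radialConstant (d : ℕ) (β : ℝ) : ℝ := d * unitBallVolume d / (β + d)

lemma integrable_radialPower {d : ℕ} (hd : 1 ≤ d) {β : ℝ} (hβ : -(d : ℝ) < β) (r : ℝ) :
    Integrable fun z : EuclideanSpace ℝ (Fin d) => radialPower β r ‖z‖ := by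
  have : Nonempty (Fin d) := ⟨⟨0, hd⟩⟩
  rw [integrable_fun_norm_addHaar volume (f := radialPower β r), finrank_euclideanSpace_fin,
    integrableOn_congr_fun (smul_radialPower_eq hd β r) measurableSet_Ioi]
  refine IntegrableOn.integrable_indicator ?_ measurableSet_Ioc |>.integrableOn
  rcases le_total 0 r with hr | hr
  · rw [← intervalIntegrable_iff_integrableOn_Ioc_of_le hr]
    exact intervalIntegral.intervalIntegrable_rpow' (by linarith)
  · simp [Set.Ioc_eq_empty_of_le hr]

lemma integral_radialPower {d : ℕ} (hd : 1 ≤ d) {β r : ℝ} (hβ : -(d : ℝ) < β) (hr : 0 < r) :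
    ∫ z : EuclideanSpace ℝ (Fin d), radialPower β r ‖z‖ = radialConstant d β * r ^ (β + d) := by
  have : Nonempty (Fin d) := ⟨⟨0, hd⟩⟩
  rw [integral_fun_norm_addHaar, finrank_euclideanSpace_fin,
    setIntegral_congr_fun measurableSet_Ioi (smul_radialPower_eq hd β r),
    setIntegral_indicator measurableSet_Ioc,
    Set.inter_eq_right.mpr Set.Ioc_subset_Ioi_self, ← intervalIntegral.integral_of_le hr.le,
    integral_rpow (Or.inl (by linarith)), ← Measure.addHaar_real_closedBall_eq_addHaar_real_ball]
  have h : β + d - 1 + 1 = β + d := by ring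
  rw [h, Real.zero_rpow (by linarith), radialConstant, unitBallVolume, smul_eq_mul, nsmul_eq_mul]
  ring

/-- The contribution of a pair of points to the length-power functional, as an extended
nonnegative real. -/
def edgeKernel {d : ℕ} (α r : ℝ)
    (p : EuclideanSpace ℝ (Fin d) × EuclideanSpace ℝ (Fin d)) : ℝ≥0∞ :=
  ENNReal.ofReal (radialPower α r ‖p.1 - p.2‖)

lemma measurable_edgeKernel {d : ℕ} (α r : ℝ) : Measurable (edgeKernel (d := d) α r) :=
  ((measurable_radialPower α r).comp (by fun_prop)).ennreal_ofReal

lemma edgeKernel_symm {d : ℕ} (α r : ℝ) (x y : EuclideanSpace ℝ (Fin d)) :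
    edgeKernel α r (x, y) = edgeKernel α r (y, x) := by
  simp only [edgeKernel, norm_sub_rev]

lemma lengthPower_eq {d : ℕ} (α r : ℝ) (s : Finset (EuclideanSpace ℝ (Fin d))) :
    lengthPower α r s = 1 / 2 * (pairSum (edgeKernel α r) s).toReal := by
  rw [lengthPower, pairSum,
    ENNReal.toReal_sum (f := edgeKernel α r) fun p _ => ENNReal.ofReal_ne_top]
  congr 1
  exact Finset.sum_congr rfl fun p _ =>
    (ENNReal.toReal_ofReal (radialPower_nonneg (norm_nonneg _))).symm

/-- The integral over `y ∈ W` of the `β`-th power of the distance to `x`, cut off beyond `r`. -/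
def localIntegral {d : ℕ} (W : Set (EuclideanSpace ℝ (Fin d))) (β r : ℝ)
    (x : EuclideanSpace ℝ (Fin d)) : ℝ :=
  ∫ y in W, radialPower β r ‖x - y‖

section

variable {d : ℕ} {W : Set (EuclideanSpace ℝ (Fin d))} {β r : ℝ}

lemma integrable_radialPower_sub (hd : 1 ≤ d) (hβ : -(d : ℝ) < β) (r : ℝ)
    (x : EuclideanSpace ℝ (Fin d)) :
    Integrable fun y : EuclideanSpace ℝ (Fin d) => radialPower β r ‖x - y‖ :=
  (integrable_radialPower hd hβ r).comp_sub_left x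

lemma localIntegral_nonneg (x : EuclideanSpace ℝ (Fin d)) : 0 ≤ localIntegral W β r x :=
  integral_nonneg fun _ => radialPower_nonneg (norm_nonneg _)

lemma localIntegral_le (hd : 1 ≤ d) (hβ : -(d : ℝ) < β) (hr : 0 < r)
    (x : EuclideanSpace ℝ (Fin d)) :
    localIntegral W β r x ≤ radialConstant d β * r ^ (β + d) := by
  rw [← integral_radialPower hd hβ hr,
    ← integral_sub_left_eq_self (fun z => radialPower β r ‖z‖) volume x]
  exact setIntegral_le_integral (integrable_radialPower_sub hd hβ r x)
    (Eventually.of_forall fun _ => radialPower_nonneg (norm_nonneg _))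

lemma localIntegral_eq (hd : 1 ≤ d) (hβ : -(d : ℝ) < β) (hr : 0 < r)
    {x : EuclideanSpace ℝ (Fin d)} (hx : Metric.closedBall x r ⊆ W) :
    localIntegral W β r x = radialConstant d β * r ^ (β + d) := by
  rw [← integral_radialPower hd hβ hr,
    ← integral_sub_left_eq_self (fun z => radialPower β r ‖z‖) volume x]
  refine setIntegral_eq_integral_of_forall_compl_eq_zero fun y hy => if_neg fun h => hy (hx ?_)
  rwa [Metric.mem_closedBall, dist_comm, dist_eq_norm]

lemma lintegral_edgeKernel (hd : 1 ≤ d) (hβ : -(d : ℝ) < β) (x : EuclideanSpace ℝ (Fin d)) :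
    ∫⁻ y in W, edgeKernel β r (x, y) = ENNReal.ofReal (localIntegral W β r x) :=
  (ofReal_integral_eq_lintegral_ofReal (integrable_radialPower_sub hd hβ r x).integrableOn
    (Eventually.of_forall fun _ => radialPower_nonneg (norm_nonneg _))).symm

lemma measurable_localIntegral (hd : 1 ≤ d) (hβ : -(d : ℝ) < β) :
    Measurable (localIntegral W β r) := by
  have : localIntegral W β r = fun x => (∫⁻ y in W, edgeKernel β r (x, y)).toReal := by
    ext x
    rw [lintegral_edgeKernel hd hβ, ENNReal.toReal_ofReal (localIntegral_nonneg x)]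
  rw [this]
  exact (measurable_edgeKernel β r).lintegral_prod_right'.ennreal_toReal

/-- The exponents add up only off the diagonal, where the junk value of `0 ^ α` plays no role. -/
lemma edgeKernel_mul_ae (α α' r : ℝ) (μ : Measure (EuclideanSpace ℝ (Fin d)))
    [NullSingletonClass μ] (x : EuclideanSpace ℝ (Fin d)) :
    (fun y => edgeKernel α r (x, y) * edgeKernel α' r (x, y)) =ᵐ[μ]
      fun y => edgeKernel (α + α') r (x, y) := by
  filter_upwards [compl_mem_ae_iff.mpr (measure_singleton x)] with y hy
  have hpos : 0 < ‖x - y‖ := norm_pos_iff.mpr (sub_ne_zero.mpr fun h => hy h.symm)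
  rw [edgeKernel, edgeKernel, edgeKernel, ← ENNReal.ofReal_mul (radialPower_nonneg hpos.le)]
  simp only [radialPower]
  split_ifs
  · rw [Real.rpow_add hpos]
  · simp

end

/-- The local integral divided by its order of magnitude `r ^ (β + d)`. -/
def scaledLocalIntegral {d : ℕ} (W : Set (EuclideanSpace ℝ (Fin d))) (β r : ℝ)
    (x : EuclideanSpace ℝ (Fin d)) : ℝ :=
  localIntegral W β r x / r ^ (β + d)

section

variable {d : ℕ} {W : Set (EuclideanSpace ℝ (Fin d))} {β r : ℝ}

lemma scaledLocalIntegral_nonneg (hr : 0 < r) (x : EuclideanSpace ℝ (Fin d)) :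
    0 ≤ scaledLocalIntegral W β r x :=
  div_nonneg (localIntegral_nonneg x) (Real.rpow_pos_of_pos hr _).le

lemma scaledLocalIntegral_le (hd : 1 ≤ d) (hβ : -(d : ℝ) < β) (hr : 0 < r)
    (x : EuclideanSpace ℝ (Fin d)) : scaledLocalIntegral W β r x ≤ radialConstant d β :=
  (div_le_iff₀ (Real.rpow_pos_of_pos hr _)).mpr (localIntegral_le hd hβ hr x)

lemma measurable_scaledLocalIntegral (hd : 1 ≤ d) (hβ : -(d : ℝ) < β) :
    Measurable (scaledLocalIntegral W β r) :=
  (measurable_localIntegral hd hβ).div_const _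

lemma abs_scaledLocalIntegral_le (hd : 1 ≤ d) (hβ : -(d : ℝ) < β) (hr : 0 < r)
    (x : EuclideanSpace ℝ (Fin d)) : ‖scaledLocalIntegral W β r x‖ ≤ radialConstant d β := by
  rw [Real.norm_of_nonneg (scaledLocalIntegral_nonneg hr x)]
  exact scaledLocalIntegral_le hd hβ hr x

lemma tendsto_scaledLocalIntegral (hd : 1 ≤ d) (hβ : -(d : ℝ) < β)
    {x : EuclideanSpace ℝ (Fin d)} (hx : x ∈ interior W) :
    Tendsto (fun r => scaledLocalIntegral W β r x) (𝓝[>] 0) (𝓝 (radialConstant d β)) := by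
  obtain ⟨ε, hε, hball⟩ := Metric.isOpen_iff.mp isOpen_interior x hx
  refine tendsto_const_nhds.congr' ?_
  filter_upwards [Ioo_mem_nhdsGT hε] with r hr
  have hsub : Metric.closedBall x r ⊆ W :=
    ((Metric.closedBall_subset_ball hr.2).trans hball).trans interior_subset
  rw [scaledLocalIntegral, localIntegral_eq hd hβ hr.1 hsub,
    mul_div_cancel_right₀ _ (Real.rpow_pos_of_pos hr.1 _).ne']

lemma ae_mem_interior (hWc : IsClosed W) (hW : Convex ℝ W) :
    ∀ᵐ x ∂(volume.restrict W), x ∈ interior W := by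
  rw [ae_restrict_iff' hWc.measurableSet]
  filter_upwards [compl_mem_ae_iff.mpr (hW.addHaar_frontier volume)] with x hx hxW
  by_contra h
  exact hx ⟨subset_closure hxW, h⟩

lemma tendsto_integral_scaledLocalIntegral (hd : 1 ≤ d) (hβ : -(d : ℝ) < β)
    (hWc : IsCompact W) (hW : Convex ℝ W) :
    Tendsto (fun r => ∫ x in W, scaledLocalIntegral W β r x) (𝓝[>] 0)
      (𝓝 (volume.real W * radialConstant d β)) := by
  have : IsFiniteMeasure (volume.restrict W) := ⟨by simpa using hWc.measure_lt_top⟩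
  have hlim : volume.real W * radialConstant d β = ∫ _ in W, radialConstant d β := by simp
  rw [hlim]
  refine tendsto_integral_filter_of_dominated_convergence (fun _ => radialConstant d β) ?_ ?_
    (integrable_const _) ?_
  · exact Eventually.of_forall fun r => (measurable_scaledLocalIntegral hd hβ).aestronglyMeasurable
  · filter_upwards [self_mem_nhdsWithin] with r hr
    exact Eventually.of_forall (abs_scaledLocalIntegral_le hd hβ hr)
  · filter_upwards [ae_mem_interior hWc.isClosed hW] with x hx
    exact tendsto_scaledLocalIntegral hd hβ hx

lemma tendsto_integral_scaledLocalIntegral_mul {β' : ℝ} (hd : 1 ≤ d) (hβ : -(d : ℝ) < β)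
    (hβ' : -(d : ℝ) < β') (hWc : IsCompact W) (hW : Convex ℝ W) :
    Tendsto (fun r => ∫ x in W, scaledLocalIntegral W β r x * scaledLocalIntegral W β' r x)
      (𝓝[>] 0) (𝓝 (volume.real W * (radialConstant d β * radialConstant d β'))) := by
  have : IsFiniteMeasure (volume.restrict W) := ⟨by simpa using hWc.measure_lt_top⟩
  have hlim : volume.real W * (radialConstant d β * radialConstant d β') =
      ∫ _ in W, radialConstant d β * radialConstant d β' := by simp
  rw [hlim]
  refine tendsto_integral_filter_of_dominated_convergence
    (fun _ => radialConstant d β * radialConstant d β') ?_ ?_ (integrable_const _) ?_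
  · exact Eventually.of_forall fun r => ((measurable_scaledLocalIntegral hd hβ).mul
      (measurable_scaledLocalIntegral hd hβ')).aestronglyMeasurable
  · filter_upwards [self_mem_nhdsWithin] with r hr
    refine Eventually.of_forall fun x => ?_
    rw [norm_mul]
    have h := abs_scaledLocalIntegral_le (W := W) hd hβ hr x
    exact mul_le_mul h (abs_scaledLocalIntegral_le hd hβ' hr x) (norm_nonneg _)
      ((norm_nonneg _).trans h)
  · filter_upwards [ae_mem_interior hWc.isClosed hW] with x hx
    exact (tendsto_scaledLocalIntegral hd hβ hx).mul (tendsto_scaledLocalIntegral hd hβ' hx)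

end

/-! ### The covariance of length-power functionals -/

lemma IsPoissonProcess.hasPoissonVoids {d : ℕ} {Ω : Type*} [MeasurableSpace Ω]
    {W : Set (EuclideanSpace ℝ (Fin d))} (hW : MeasurableSet W) {t : ℝ} (ht : 0 ≤ t)
    {η : Ω → Finset (EuclideanSpace ℝ (Fin d))} {P : Measure Ω} (h : IsPoissonProcess W t η P) :
    HasPoissonVoids (ENNReal.ofReal t • volume.restrict W) η P := by
  have key (A : Set (EuclideanSpace ℝ (Fin d))) :
      {ω | Disjoint (η ω : Set (EuclideanSpace ℝ (Fin d))) A} =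
        {ω | ((η ω : Set (EuclideanSpace ℝ (Fin d))) ∩ (A ∩ W)).ncard = 0} := by
    ext ω
    have : (η ω : Set (EuclideanSpace ℝ (Fin d))) ∩ (A ∩ W) = ↑(η ω) ∩ A := by
      rw [Set.inter_comm A, ← Set.inter_assoc, Set.inter_eq_left.mpr (h.subset_window ω)]
    rw [Set.mem_ofPred_eq, Set.mem_ofPred_eq, this,
      Set.ncard_eq_zero ((η ω).finite_toSet.inter_of_left A), Set.disjoint_iff_inter_eq_empty]
  refine ⟨fun A hA => ?_, fun A hA => ?_⟩
  · rw [key]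
    exact h.measurable_count _ (hA.inter hW) Set.inter_subset_right (measurableSet_singleton 0)
  · rw [key, h.void_probability _ (hA.inter hW) Set.inter_subset_right,
      measureReal_ennreal_smul_apply, measureReal_restrict_apply hA, ENNReal.toReal_ofReal ht]

section

variable {d : ℕ} {W : Set (EuclideanSpace ℝ (Fin d))}

lemma lintegral_lintegral_edgeKernel (hd : 1 ≤ d) (hW : volume W ≠ ∞) {β r : ℝ}
    (hβ : -(d : ℝ) < β) (hr : 0 < r) :
    ∫⁻ x in W, ∫⁻ y in W, edgeKernel β r (x, y) =
      ENNReal.ofReal (r ^ (β + d) * ∫ x in W, scaledLocalIntegral W β r x) := by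
  have : IsFiniteMeasure (volume.restrict W) := ⟨by simpa using hW.lt_top⟩
  have hpos := Real.rpow_pos_of_pos hr (β + d)
  simp_rw [lintegral_edgeKernel hd hβ]
  rw [← integral_const_mul, ofReal_integral_eq_lintegral_ofReal]
  · refine lintegral_congr fun x => ?_
    rw [scaledLocalIntegral, mul_div_cancel₀ _ hpos.ne']
  · exact (Integrable.of_bound (measurable_scaledLocalIntegral hd hβ).aestronglyMeasurable _
      (Eventually.of_forall (abs_scaledLocalIntegral_le hd hβ hr))).const_mul _
  · exact Eventually.of_forall fun x => mul_nonneg hpos.le (scaledLocalIntegral_nonneg hr x)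

lemma lintegral_mul_lintegral_edgeKernel (hd : 1 ≤ d) (hW : volume W ≠ ∞) {β β' r : ℝ}
    (hβ : -(d : ℝ) < β) (hβ' : -(d : ℝ) < β') (hr : 0 < r) :
    ∫⁻ x in W, (∫⁻ y in W, edgeKernel β r (x, y)) * ∫⁻ y in W, edgeKernel β' r (x, y) =
      ENNReal.ofReal (r ^ (β + d) * r ^ (β' + d) *
        ∫ x in W, scaledLocalIntegral W β r x * scaledLocalIntegral W β' r x) := by
  have : IsFiniteMeasure (volume.restrict W) := ⟨by simpa using hW.lt_top⟩
  have hpos := Real.rpow_pos_of_pos hr (β + d)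
  have hpos' := Real.rpow_pos_of_pos hr (β' + d)
  simp_rw [lintegral_edgeKernel hd hβ, lintegral_edgeKernel hd hβ']
  rw [← integral_const_mul, ofReal_integral_eq_lintegral_ofReal]
  · refine lintegral_congr fun x => ?_
    rw [← ENNReal.ofReal_mul (localIntegral_nonneg x), scaledLocalIntegral, scaledLocalIntegral]
    congr 1
    field_simp
  · refine (Integrable.of_bound ((measurable_scaledLocalIntegral hd hβ).mul
      (measurable_scaledLocalIntegral hd hβ')).aestronglyMeasurable
      (radialConstant d β * radialConstant d β') (Eventually.of_forall fun x => ?_)).const_mul _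
    have h := abs_scaledLocalIntegral_le (W := W) hd hβ hr x
    rw [Pi.mul_apply, norm_mul]
    exact mul_le_mul h (abs_scaledLocalIntegral_le hd hβ' hr x) (norm_nonneg _)
      ((norm_nonneg _).trans h)
  · exact Eventually.of_forall fun x => mul_nonneg (mul_pos hpos hpos').le
      (mul_nonneg (scaledLocalIntegral_nonneg hr x) (scaledLocalIntegral_nonneg hr x))

lemma lintegral_edgeKernel_mul (hd : 1 ≤ d) (hW : volume W ≠ ∞) {α α' r : ℝ}
    (hα : -((d : ℝ) / 2) < α) (hα' : -((d : ℝ) / 2) < α') (hr : 0 < r) :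
    ∫⁻ x in W, ∫⁻ y in W, edgeKernel α r (x, y) * edgeKernel α' r (x, y) =
      ENNReal.ofReal (r ^ (α + α' + d) * ∫ x in W, scaledLocalIntegral W (α + α') r x) := by
  have : Nonempty (Fin d) := ⟨⟨0, hd⟩⟩
  rw [← lintegral_lintegral_edgeKernel hd hW (by linarith) hr]
  exact lintegral_congr fun x => lintegral_congr_ae (edgeKernel_mul_ae α α' r _ x)

lemma neg_natCast_lt_of_neg_half_lt {α : ℝ} (hα : -((d : ℝ) / 2) < α) : -(d : ℝ) < α := by
  have : (0 : ℝ) ≤ d := d.cast_nonneg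
  linarith

lemma squareIntegrableKernel_edgeKernel (hd : 1 ≤ d) (hW : volume W ≠ ∞) {α r : ℝ} (t : ℝ)
    (hα : -((d : ℝ) / 2) < α) (hr : 0 < r) :
    SquareIntegrableKernel (ENNReal.ofReal t • volume.restrict W) (edgeKernel α r) := by
  have hα' := neg_natCast_lt_of_neg_half_lt hα
  refine ⟨measurable_edgeKernel α r, edgeKernel_symm α r, ?_, ?_, ?_⟩
  · simp_rw [lintegral_smul_measure, smul_eq_mul]
    rw [lintegral_const_mul' _ _ ENNReal.ofReal_ne_top, lintegral_lintegral_edgeKernel hd hW hα' hr]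
    finiteness
  · simp_rw [lintegral_smul_measure, smul_eq_mul]
    rw [lintegral_const_mul' _ _ ENNReal.ofReal_ne_top, lintegral_edgeKernel_mul hd hW hα hα hr]
    finiteness
  · simp_rw [lintegral_smul_measure, smul_eq_mul, mul_mul_mul_comm]
    rw [lintegral_const_mul' _ _ (by finiteness),
      lintegral_mul_lintegral_edgeKernel hd hW hα' hα' hr]
    finiteness

variable {Ω : Type*} [MeasurableSpace Ω] {P : Measure Ω} [IsProbabilityMeasure P] {t : ℝ}
  {η : Ω → Finset (EuclideanSpace ℝ (Fin d))}

lemma IsPoissonProcess.memLp_lengthPower (h : IsPoissonProcess W t η P) (hd : 1 ≤ d)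
    (hWc : IsCompact W) (ht : 0 < t) {α r : ℝ} (hα : -((d : ℝ) / 2) < α) (hr : 0 < r) :
    MemLp (fun ω => lengthPower α r (η ω)) 2 P := by
  have : Nonempty (Fin d) := ⟨⟨0, hd⟩⟩
  have : IsFiniteMeasure (volume.restrict W) := ⟨by simpa using hWc.measure_lt_top⟩
  have : IsFiniteMeasure (ENNReal.ofReal t • volume.restrict W) :=
    Measure.smul_finite _ ENNReal.ofReal_ne_top
  have : NullSingletonClass (ENNReal.ofReal t • volume.restrict W) := ⟨fun x => by simp⟩
  simp_rw [lengthPower_eq]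
  exact ((h.hasPoissonVoids hWc.measurableSet ht.le).memLp_pairSum
    (squareIntegrableKernel_edgeKernel hd hWc.measure_lt_top.ne t hα hr)).const_mul _

lemma IsPoissonProcess.covariance_lengthPower (h : IsPoissonProcess W t η P) (hd : 1 ≤ d)
    (hWc : IsCompact W) (ht : 0 < t) {α α' r : ℝ} (hα : -((d : ℝ) / 2) < α)
    (hα' : -((d : ℝ) / 2) < α') (hr : 0 < r) :
    ProbabilityTheory.covariance (fun ω => lengthPower α r (η ω))
      (fun ω => lengthPower α' r (η ω)) P =
      t ^ 3 * (r ^ (α + d) * r ^ (α' + d)) *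
        (∫ x in W, scaledLocalIntegral W α r x * scaledLocalIntegral W α' r x) +
      t ^ 2 / 2 * r ^ (α + α' + d) * ∫ x in W, scaledLocalIntegral W (α + α') r x := by
  have : Nonempty (Fin d) := ⟨⟨0, hd⟩⟩
  have : IsFiniteMeasure (volume.restrict W) := ⟨by simpa using hWc.measure_lt_top⟩
  have : IsFiniteMeasure (ENNReal.ofReal t • volume.restrict W) :=
    Measure.smul_finite _ ENNReal.ofReal_ne_top
  have : NullSingletonClass (ENNReal.ofReal t • volume.restrict W) := ⟨fun x => by simp⟩
  have hWt : volume W ≠ ∞ := hWc.measure_lt_top.ne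
  simp_rw [lengthPower_eq]
  rw [ProbabilityTheory.covariance_const_mul_left, ProbabilityTheory.covariance_const_mul_right,
    (h.hasPoissonVoids hWc.measurableSet ht.le).covariance_pairSum
      (squareIntegrableKernel_edgeKernel hd hWt t hα hr)
      (squareIntegrableKernel_edgeKernel hd hWt t hα' hr)]
  simp_rw [lintegral_smul_measure, smul_eq_mul, mul_mul_mul_comm]
  rw [lintegral_const_mul' _ _ (by finiteness), lintegral_const_mul' _ _ (by finiteness),
    lintegral_mul_lintegral_edgeKernel hd hWt (neg_natCast_lt_of_neg_half_lt hα)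
      (neg_natCast_lt_of_neg_half_lt hα') hr,
    lintegral_edgeKernel_mul hd hWt hα hα' hr]
  have hI : 0 ≤ ∫ x in W, scaledLocalIntegral W α r x * scaledLocalIntegral W α' r x :=
    integral_nonneg fun x =>
      mul_nonneg (scaledLocalIntegral_nonneg hr x) (scaledLocalIntegral_nonneg hr x)
  have hJ : 0 ≤ ∫ x in W, scaledLocalIntegral W (α + α') r x :=
    integral_nonneg fun x => scaledLocalIntegral_nonneg hr x
  simp only [ENNReal.toReal_mul, ENNReal.toReal_ofReal ht.le]
  rw [ENNReal.toReal_ofReal (by positivity), ENNReal.toReal_ofReal (by positivity)]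
  ring

end

/-- The second term of the maximum is the first one multiplied by `√(t r^d)`. -/
lemma normalization_eq {t r : ℝ} (ht : 0 < t) (hr : 0 < r) (α : ℝ) (d : ℕ) :
    max (t * r ^ (α + (d : ℝ) / 2)) (t ^ ((3 : ℝ) / 2) * r ^ (α + (d : ℝ))) =
      t * r ^ (α + (d : ℝ) / 2) * √(max 1 (t * r ^ d)) := by
  have h : t ^ ((3 : ℝ) / 2) * r ^ (α + (d : ℝ)) = t * r ^ (α + (d : ℝ) / 2) * √(t * r ^ d) := by
    rw [Real.sqrt_mul ht.le, Real.sqrt_eq_rpow, Real.sqrt_eq_rpow, ← Real.rpow_natCast r,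
      ← Real.rpow_mul hr.le, show (3 : ℝ) / 2 = 1 + 1 / 2 by norm_num, Real.rpow_add ht,
      Real.rpow_one, show α + (d : ℝ) = α + d / 2 + d * (1 / 2) by ring,
      Real.rpow_add hr (α + d / 2)]
    ring
  rw [h, Real.sqrt_monotone.map_max, Real.sqrt_one, mul_max_of_nonneg _ _ (by positivity), mul_one]

lemma IsPoissonProcess.covariance_normalizedLengthPower {d : ℕ}
    {W : Set (EuclideanSpace ℝ (Fin d))} {Ω : Type*} [MeasurableSpace Ω] {P : Measure Ω}
    [IsProbabilityMeasure P] {t : ℝ} {η : Ω → Finset (EuclideanSpace ℝ (Fin d))}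
    (h : IsPoissonProcess W t η P) (hd : 1 ≤ d)
    (hWc : IsCompact W) (ht : 0 < t) {α α' r : ℝ} (hα : -((d : ℝ) / 2) < α)
    (hα' : -((d : ℝ) / 2) < α') (hr : 0 < r) :
    ProbabilityTheory.covariance (fun ω => normalizedLengthPower α t r (η ω))
      (fun ω => normalizedLengthPower α' t r (η ω)) P =
      1 / max 1 (t * r ^ d) * ((∫ x in W, scaledLocalIntegral W (α + α') r x) / 2) +
      t * r ^ d / max 1 (t * r ^ d) *
        ∫ x in W, scaledLocalIntegral W α r x * scaledLocalIntegral W α' r x := by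
  simp_rw [normalizedLengthPower]
  rw [ProbabilityTheory.covariance_fun_div_left, ProbabilityTheory.covariance_fun_div_right,
    h.covariance_lengthPower hd hWc ht hα hα' hr, normalization_eq ht hr, normalization_eq ht hr]
  set M := max 1 (t * r ^ d) with hM
  have hMpos : 0 < M := lt_max_of_lt_left one_pos
  have hs : √M * √M = M := Real.mul_self_sqrt hMpos.le
  have hspos : 0 < √M := Real.sqrt_pos.mpr hMpos
  have hr1 : r ^ (α + α' + d) = r ^ (α + (d : ℝ) / 2) * r ^ (α' + (d : ℝ) / 2) := by
    rw [← Real.rpow_add hr]; congr 1; ring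
  have hr2 : r ^ (α + d) * r ^ (α' + d) =
      r ^ (α + (d : ℝ) / 2) * r ^ (α' + (d : ℝ) / 2) * r ^ d := by
    rw [← Real.rpow_natCast r d, ← Real.rpow_add hr, ← Real.rpow_add hr, ← Real.rpow_add hr]
    congr 1; ring
  rw [hr1, hr2]
  have hp := Real.rpow_pos_of_pos hr (α + (d : ℝ) / 2)
  have hp' := Real.rpow_pos_of_pos hr (α' + (d : ℝ) / 2)
  generalize r ^ (α + (d : ℝ) / 2) = a at *
  generalize r ^ (α' + (d : ℝ) / 2) = b at *
  clear_value M
  generalize √M = q at *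
  subst hs
  field_simp
  ring

/-! ### The limit of the covariance matrix -/

/-- The limit of the covariance matrix in terms of the limits `a` and `b` of the two coefficients,
which is where the three regimes differ. -/
lemma tendsto_covMatrix {d m : ℕ} (hd : 1 ≤ d) {Ω : Type*} [MeasurableSpace Ω] {P : Measure Ω}
    [IsProbabilityMeasure P] {W : Set (EuclideanSpace ℝ (Fin d))} (hWc : IsCompact W)
    (hW : Convex ℝ W) {η : ℝ → Ω → Finset (EuclideanSpace ℝ (Fin d))}
    (hη : ∀ t : ℝ, 0 < t → IsPoissonProcess W t (η t) P) {δ : ℝ → ℝ}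
    (hδpos : ∀ t : ℝ, 0 < t → 0 < δ t) (hδ : Tendsto δ atTop (𝓝 0)) {α : Fin m → ℝ}
    (hα : ∀ i, -((d : ℝ) / 2) < α i) {a b : ℝ}
    (ha : Tendsto (fun t => 1 / max 1 (t * δ t ^ d)) atTop (𝓝 a))
    (hb : Tendsto (fun t => t * δ t ^ d / max 1 (t * δ t ^ d)) atTop (𝓝 b)) :
    Tendsto (covMatrix P η δ α) atTop (𝓝 (a • sigmaOne W α + b • sigmaTwo W α)) := by
  have hδ' : Tendsto δ atTop (𝓝[>] 0) := by
    refine tendsto_nhdsWithin_iff.mpr ⟨hδ, ?_⟩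
    filter_upwards [eventually_gt_atTop 0] with t ht using hδpos t ht
  refine tendsto_pi_nhds.mpr fun i => tendsto_pi_nhds.mpr fun j => ?_
  have hi := neg_natCast_lt_of_neg_half_lt (hα i)
  have hj := neg_natCast_lt_of_neg_half_lt (hα j)
  have hij : -(d : ℝ) < α i + α j := by linarith [hα i, hα j]
  have h1 := ((tendsto_integral_scaledLocalIntegral hd hij hWc hW).comp hδ').div_const 2
  have h2 := (tendsto_integral_scaledLocalIntegral_mul hd hi hj hWc hW).comp hδ'
  have hlim : (a • sigmaOne W α + b • sigmaTwo W α) i j =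
      a * (volume.real W * radialConstant d (α i + α j) / 2) +
        b * (volume.real W * (radialConstant d (α i) * radialConstant d (α j))) := by
    have : α i + d ≠ 0 := by linarith
    have : α j + d ≠ 0 := by linarith
    have : α i + α j + d ≠ 0 := by linarith
    simp only [sigmaOne, sigmaTwo, radialConstant, Matrix.add_apply, Matrix.smul_apply,
      Matrix.of_apply, smul_eq_mul]
    field_simp
  rw [hlim]
  refine ((ha.mul h1).add (hb.mul h2)).congr' ?_
  filter_upwards [eventually_gt_atTop 0] with t ht
  exact ((hη t ht).covariance_normalizedLengthPower hd hWc ht (hα i) (hα j) (hδpos t ht)).symm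

/-! ### Positive definiteness and rank of the limit matrices -/

/-- Linear independence of distinct exponentials: evaluated at the positive integers, a vanishing
combination becomes a Vandermonde system. -/
lemma sum_mul_exp_ne_zero {m : ℕ} {β c : Fin m → ℝ} (hβ : Function.Injective β) (hc : c ≠ 0) :
    ∃ s : ℝ, 0 < s ∧ ∑ i, c i * Real.exp (-β i * s) ≠ 0 := by
  by_contra! h
  refine hc ?_
  have hinj : Function.Injective fun i => Real.exp (-β i) := fun i j hij =>
    hβ (neg_injective (Real.exp_injective hij))
  have := Matrix.eq_zero_of_forall_pow_sum_mul_pow_eq_zero (v := fun i => c i * Real.exp (-β i))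
    hinj fun n => by
      rw [← h (n + 1) (by positivity)]
      refine Finset.sum_congr rfl fun i _ => ?_
      rw [mul_assoc, ← Real.exp_nat_mul, ← Real.exp_add]
      congr 2; ring
  ext i
  simpa using congrFun this i

/-- The quadratic form of a Cauchy matrix is `∫ (∑ i, c i * exp (-β i * s)) ^ 2` over `s > 0`. -/
lemma posDef_cauchy {m : ℕ} {β : Fin m → ℝ} (hpos : ∀ i, 0 < β i) (hβ : Function.Injective β) :
    (Matrix.of fun i j => 1 / (β i + β j)).PosDef := by
  refine Matrix.PosDef.of_dotProduct_mulVec_pos ?_ fun c hc => ?_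
  · ext i j
    simp [add_comm]
  let φ : ℝ → ℝ := fun s => (∑ i, c i * Real.exp (-β i * s)) ^ 2
  have hφ : φ = fun s => ∑ i, ∑ j, c i * c j * Real.exp (-(β i + β j) * s) := by
    ext s
    simp only [φ]
    rw [sq, Finset.sum_mul_sum]
    refine Finset.sum_congr rfl fun i _ => Finset.sum_congr rfl fun j _ => ?_
    rw [neg_add, add_mul, Real.exp_add]
    ring
  have hneg i j : -(β i + β j) < 0 := by linarith [hpos i, hpos j]
  have hterm i j : IntegrableOn (fun s => c i * c j * Real.exp (-(β i + β j) * s)) (Set.Ioi 0) :=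
    (integrableOn_exp_mul_Ioi (hneg i j) 0).const_mul _
  have hint : IntegrableOn φ (Set.Ioi 0) := by
    rw [hφ]
    exact integrable_finsetSum _ fun i _ => integrable_finsetSum _ fun j _ => hterm i j
  have hval : star c ⬝ᵥ (Matrix.of fun i j => 1 / (β i + β j)).mulVec c =
      ∫ s in Set.Ioi (0 : ℝ), φ s := by
    rw [hφ, integral_finsetSum _ fun i _ => integrable_finsetSum _ fun j _ => hterm i j]
    simp only [dotProduct, Matrix.mulVec, Finset.mul_sum]
    refine Finset.sum_congr rfl fun i _ => ?_
    rw [integral_finsetSum _ fun j _ => hterm i j]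
    refine Finset.sum_congr rfl fun j _ => ?_
    rw [integral_const_mul, integral_exp_mul_Ioi (hneg i j)]
    rw [mul_zero, Real.exp_zero, neg_div_neg_eq]
    simp only [Pi.star_apply, star_trivial, Matrix.of_apply]
    ring
  rw [hval, setIntegral_pos_iff_support_of_nonneg_ae
    (Eventually.of_forall fun s => sq_nonneg _) hint]
  have hcont : Continuous φ := by fun_prop
  obtain ⟨s, hs, hne⟩ := sum_mul_exp_ne_zero hβ hc
  exact ((hcont.isOpen_support).inter isOpen_Ioi).measure_pos volume ⟨s, pow_ne_zero 2 hne, hs⟩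

lemma unitBallVolume_pos (d : ℕ) : 0 < unitBallVolume d :=
  ENNReal.toReal_pos (Metric.measure_closedBall_pos volume _ one_pos).ne'
    measure_closedBall_lt_top.ne

lemma posDef_sigmaOne {d m : ℕ} (hd : 1 ≤ d) {W : Set (EuclideanSpace ℝ (Fin d))}
    (hW : 0 < volume.real W) {α : Fin m → ℝ} (hα : ∀ i, -((d : ℝ) / 2) < α i)
    (hinj : Function.Injective α) : (sigmaOne W α).PosDef := by
  have h := posDef_cauchy (β := fun i => α i + (d : ℝ) / 2) (fun i => by linarith [hα i])
    fun i j hij => hinj (by simpa using hij)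
  have heq : (Matrix.of fun i j => 1 / ((α i + (d : ℝ) / 2) + (α j + (d : ℝ) / 2))) =
      Matrix.of fun i j => 1 / (α i + α j + (d : ℝ)) := by
    ext i j
    simp only [Matrix.of_apply]
    congr 1; ring
  rw [heq] at h
  have := unitBallVolume_pos d
  have : (0 : ℝ) < d := by exact_mod_cast hd
  exact h.smul (by positivity)

lemma sigmaTwo_eq {d m : ℕ} (W : Set (EuclideanSpace ℝ (Fin d))) (α : Fin m → ℝ) :
    sigmaTwo W α = ((d : ℝ) ^ 2 * unitBallVolume d ^ 2 * volume.real W) •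
      Matrix.vecMulVec (fun i => 1 / (α i + d)) (star fun i => 1 / (α i + d)) := by
  rw [sigmaTwo]
  congr 1
  ext i j
  simp [Matrix.vecMulVec_apply, mul_comm]

lemma posSemidef_sigmaTwo {d m : ℕ} (W : Set (EuclideanSpace ℝ (Fin d))) (α : Fin m → ℝ) :
    (sigmaTwo W α).PosSemidef := by
  rw [sigmaTwo_eq]
  exact (Matrix.posSemidef_vecMulVec_self_star _).smul (by positivity)

lemma det_sigmaTwo {d m : ℕ} (hm : 2 ≤ m) (W : Set (EuclideanSpace ℝ (Fin d)))
    (α : Fin m → ℝ) : (sigmaTwo W α).det = 0 := by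
  have : Nontrivial (Fin m) := Fin.nontrivial_iff_two_le.mpr hm
  rw [sigmaTwo_eq, Matrix.det_smul, Matrix.det_vecMulVec, mul_zero]

lemma rank_sigmaTwo {d m : ℕ} (hd : 1 ≤ d) (hm : 1 ≤ m) {W : Set (EuclideanSpace ℝ (Fin d))}
    (hW : 0 < volume.real W) {α : Fin m → ℝ} (hα : ∀ i, -(d : ℝ) < α i) :
    (sigmaTwo W α).rank = 1 := by
  have hdpos : (0 : ℝ) < d := by exact_mod_cast hd
  have hκ := unitBallVolume_pos d
  refine le_antisymm ?_ (Nat.one_le_iff_ne_zero.mpr fun h0 => ?_)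
  · rw [sigmaTwo_eq, ← Matrix.smul_vecMulVec]
    exact Matrix.rank_vecMulVec_le _ _
  · rw [Matrix.rank, Module.finrank_eq_zero_iff_of_free, Submodule.subsingleton_iff_eq_bot,
      LinearMap.range_eq_bot] at h0
    have hz : sigmaTwo W α = 0 := by
      apply Matrix.mulVec_injective
      ext v i
      simpa using congrFun (LinearMap.congr_fun h0 v) i
    have hz' := congrFun (congrFun hz ⟨0, hm⟩) ⟨0, hm⟩
    have hpos : 0 < α ⟨0, hm⟩ + d := by linarith [hα ⟨0, hm⟩]
    have : 0 < sigmaTwo W α ⟨0, hm⟩ ⟨0, hm⟩ := by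
      simp only [sigmaTwo, Matrix.smul_apply, Matrix.of_apply, smul_eq_mul]
      positivity
    exact this.ne' hz'

end

end GilbertGraph

theorem proposition2p5
    {d m : ℕ} (hd : 1 ≤ d) (hm : 2 ≤ m)
    {Ω : Type*} [MeasurableSpace Ω] (P : Measure Ω) [IsProbabilityMeasure P]
    (W : Set (EuclideanSpace ℝ (Fin d)))
    (hWcompact : IsCompact W) (hWconvex : Convex ℝ W) (hWvolume : 0 < volume W)
    (η : ℝ → Ω → Finset (EuclideanSpace ℝ (Fin d)))
    (hη : ∀ t : ℝ, 0 < t → GilbertGraph.IsPoissonProcess W t (η t) P)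
    (δ : ℝ → ℝ) (hδpos : ∀ t : ℝ, 0 < t → 0 < δ t) (hδ : Tendsto δ atTop (𝓝 0))
    (α : Fin m → ℝ) (hα : ∀ i, -((d : ℝ) / 2) < α i) (hdistinct : Function.Injective α) :
    -- the functionals are square integrable, so that their covariances make sense
    (∀ t : ℝ, 0 < t → ∀ i, MemLp (fun ω => GilbertGraph.lengthPower (α i) (δ t) (η t ω)) 2 P) ∧
    -- sparse regime
    (Tendsto (fun t => t * δ t ^ d) atTop (𝓝 0) →
      Tendsto (GilbertGraph.covMatrix P η δ α) atTop (𝓝 (GilbertGraph.sigmaOne W α)) ∧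
      (GilbertGraph.sigmaOne W α).PosDef) ∧
    -- thermodynamic regime, `c ∈ (0, 1]`
    (∀ c : ℝ, 0 < c → c ≤ 1 → Tendsto (fun t => t * δ t ^ d) atTop (𝓝 c) →
      Tendsto (GilbertGraph.covMatrix P η δ α) atTop
        (𝓝 (GilbertGraph.sigmaOne W α + c • GilbertGraph.sigmaTwo W α)) ∧
      (GilbertGraph.sigmaOne W α + c • GilbertGraph.sigmaTwo W α).PosDef) ∧
    -- thermodynamic regime, `c ∈ (1, ∞)`
    (∀ c : ℝ, 1 < c → Tendsto (fun t => t * δ t ^ d) atTop (𝓝 c) →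
      Tendsto (GilbertGraph.covMatrix P η δ α) atTop
        (𝓝 ((1 / c) • GilbertGraph.sigmaOne W α + GilbertGraph.sigmaTwo W α)) ∧
      ((1 / c) • GilbertGraph.sigmaOne W α + GilbertGraph.sigmaTwo W α).PosDef) ∧
    -- dense regime
    (Tendsto (fun t => t * δ t ^ d) atTop atTop →
      Tendsto (GilbertGraph.covMatrix P η δ α) atTop (𝓝 (GilbertGraph.sigmaTwo W α)) ∧
      (GilbertGraph.sigmaTwo W α).rank = 1 ∧ (GilbertGraph.sigmaTwo W α).det = 0) := by

  have hV : 0 < volume.real W := ENNReal.toReal_pos hWvolume.ne' hWcompact.measure_lt_top.ne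
  have hS1 := GilbertGraph.posDef_sigmaOne hd hV hα hdistinct
  have hS2 := GilbertGraph.posSemidef_sigmaTwo W α
  have key {a b : ℝ} := GilbertGraph.tendsto_covMatrix (a := a) (b := b) hd hWcompact hWconvex
    hη hδpos hδ hα
  -- the two coefficients are continuous functions of `t δ_t ^ d`, which settles finite limits
  have hfin {c : ℝ} (hc : Tendsto (fun t => t * δ t ^ d) atTop (𝓝 c)) :
      Tendsto (GilbertGraph.covMatrix P η δ α) atTop
        (𝓝 ((1 / max 1 c) • GilbertGraph.sigmaOne W α +
          (c / max 1 c) • GilbertGraph.sigmaTwo W α)) := by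
    have hmax : Tendsto (fun t => max 1 (t * δ t ^ d)) atTop (𝓝 (max 1 c)) :=
      tendsto_const_nhds.max hc
    have hne : max 1 c ≠ 0 := (lt_max_of_lt_left one_pos).ne'
    exact key (tendsto_const_nhds.div hmax hne) (hc.div hmax hne)
  refine ⟨fun t ht i => (hη t ht).memLp_lengthPower hd hWcompact ht (hα i) (hδpos t ht),
    fun h => ⟨?_, hS1⟩, fun c hc hc1 h => ⟨?_, hS1.add_posSemidef (hS2.smul hc.le)⟩,
    fun c hc h => ⟨?_, (hS1.smul (by positivity)).add_posSemidef hS2⟩, fun h => ⟨?_, ?_, ?_⟩⟩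
  · simpa using hfin h
  · simpa [max_eq_left hc1] using hfin h
  · have hc0 : c ≠ 0 := by positivity
    simpa [max_eq_right hc.le, hc0] using hfin h
  · have h1 : ∀ᶠ t in atTop, max 1 (t * δ t ^ d) = t * δ t ^ d := by
      filter_upwards [h.eventually_ge_atTop 1] with t ht using max_eq_right ht
    have ha : Tendsto (fun t => 1 / max 1 (t * δ t ^ d)) atTop (𝓝 0) := by
      refine (tendsto_inv_atTop_zero.comp h).congr' ?_
      filter_upwards [h1] with t ht
      rw [ht, Function.comp_apply, one_div]
    have hb : Tendsto (fun t => t * δ t ^ d / max 1 (t * δ t ^ d)) atTop (𝓝 1) := by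
      refine tendsto_const_nhds.congr' ?_
      filter_upwards [h1, h.eventually_gt_atTop 0] with t ht hpos
      rw [ht, div_self hpos.ne']
    simpa using key ha hb
  · exact GilbertGraph.rank_sigmaTwo hd (by omega) hV
      fun i => GilbertGraph.neg_natCast_lt_of_neg_half_lt (hα i)
  · exact GilbertGraph.det_sigmaTwo hm W α
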